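/- Let $f$ be an orientation-preserving $C^\infty$ diffeomorphism of the circle $\mathbb{T}=\mathbb{R}/\mathbb{Z}$ with irrational rotation number $\alpha\in(0,1)$, and let $p_n/q_n$ ($n\ge 0$) be the convergents of the continued fraction of $\alpha$, in lowest terms (so $p_0/q_0=0/1$). For $x\in\mathbb{T}$ let $I_n(x)$ be the positively oriented arc from $x$ to $f^{q_n}(x)$ if $n$ is even, and from $f^{q_n}(x)$ to $x$ if $n$ is odd; let $\beta_n(x)=|I_n(x)|$ be its length and $M_n=\max_{x\in\mathbb{T}}\beta_n(x)$. Then there is a constant $C$, depending only on $f$, such that $$|\ln Df^{q_n}(x)|\le C\,M_n^{1/2}\qquad\text{for all } n\ge 0 \text{ and all } x\in\mathbb{T}.$$ -/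

import Mathlib

open scoped ContDiff

noncomputable section

namespace CircleDyn

/-- `F : ℝ → ℝ` is a lift of the circle map `f` of `𝕋 = ℝ / ℤ`, i.e. `F x mod 1 = f (x mod 1)`. -/
def IsLift (F : ℝ → ℝ) (f : UnitAddCircle → UnitAddCircle) : Prop :=
  ∀ x : ℝ, ((F x : ℝ) : UnitAddCircle) = f (x : UnitAddCircle)

/-- `f` is an orientation preserving smooth (`C^∞`) diffeomorphism of the circle `𝕋 = ℝ / ℤ`:
it is the projection of an increasing bijection `F` of the real line that commutes with
`x ↦ x + 1` and is of class `C^∞` together with its inverse.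
(Elements of `CircleDeg1Liftˣ` are exactly the increasing bijections of `ℝ` that commute
with `x ↦ x + 1`.) -/
def IsSmoothDiffeo (f : UnitAddCircle → UnitAddCircle) : Prop :=
  ∃ F : CircleDeg1Liftˣ, ContDiff ℝ ∞ (F : ℝ → ℝ) ∧ ContDiff ℝ ∞ (F⁻¹ : CircleDeg1Liftˣ) ∧
    IsLift F f

open Classical in
/-- The rotation number in `ℝ / ℤ` of an orientation preserving homeomorphism `f` of the circle:
the class mod `1` of `lim (Fⁿ x - x) / n`, for a lift `F` of `f`. It does not depend on the lift
(see `rotationNumber_eq`). The value is `0` if `f` is not such a homeomorphism. -/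
def rotationNumber (f : UnitAddCircle → UnitAddCircle) : UnitAddCircle :=
  if h : ∃ F : CircleDeg1Liftˣ, IsLift F f then
    ((h.choose : CircleDeg1Lift).translationNumber : UnitAddCircle)
  else 0

/-- The representative `α ∈ [0, 1)` of the rotation number of `f`. -/
def rotAngle (f : UnitAddCircle → UnitAddCircle) : ℝ :=
  (AddCircle.equivIco (1 : ℝ) 0 (rotationNumber f) : ℝ)

/-- `q_n`: the denominator, in lowest terms, of the `n`-th convergent `p_n / q_n` of
`α = rotAngle f` (so `q_0 = 1`, and `p_n / q_n = [a_1, …, a_n]` when `α = [a_1, a_2, …]`). -/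
def qden (f : UnitAddCircle → UnitAddCircle) (n : ℕ) : ℕ :=
  ((rotAngle f).convergent n).den

/-- The length in `[0, 1)` of the positively oriented arc of the circle from `x` to `y`. -/
def arcLength (x y : UnitAddCircle) : ℝ :=
  (AddCircle.equivIco (1 : ℝ) 0 (y - x) : ℝ)

/-- `β_n(x) = |I_n(x)|`, where the arc `I_n(x)` is `(x, f^{q_n}(x))` for `n` even and
`(f^{q_n}(x), x)` for `n` odd. -/
def beta (f : UnitAddCircle → UnitAddCircle) (n : ℕ) (x : UnitAddCircle) : ℝ :=
  if Even n then arcLength x (f^[qden f n] x) else arcLength (f^[qden f n] x) x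

/-- `M_n = max_x β_n(x)` (all the values `β_n(x)` lie in `[0, 1)`, so this is a genuine
supremum). -/
def maxBeta (f : UnitAddCircle → UnitAddCircle) (n : ℕ) : ℝ :=
  ⨆ x : UnitAddCircle, beta f n x

/-- The derivative `Dg(x)` of a circle map `g` at `x`, with respect to the coordinate of `ℝ / ℤ`:
the derivative at `t = 0` of the representative in `[-1/2, 1/2)` of `g (x + t) - g x`. -/
def circleDeriv (g : UnitAddCircle → UnitAddCircle) (x : UnitAddCircle) : ℝ :=
  deriv (fun t : ℝ =>
    (AddCircle.equivIco (1 : ℝ) (-1 / 2) (g (x + (t : UnitAddCircle)) - g x) : ℝ)) 0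

/-- The derivative of a circle map is the derivative of its lift. -/
theorem circleDeriv_eq_deriv {G : ℝ → ℝ} {g : UnitAddCircle → UnitAddCircle} (h : IsLift G g)
    {x : ℝ} (hc : ContinuousAt G x) : circleDeriv g (x : UnitAddCircle) = deriv G x := by
  have h1 : Filter.Tendsto (fun t : ℝ => G (x + t) - G x) (nhds 0) (nhds 0) := by
    have h2 : Filter.Tendsto (fun t : ℝ => x + t) (nhds 0) (nhds x) := by
      have h3 : Continuous fun t : ℝ => x + t := by fun_prop
      simpa using h3.tendsto 0
    simpa using (hc.tendsto.comp h2).sub_const (G x)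
  have hev : (fun t : ℝ => (AddCircle.equivIco (1 : ℝ) (-1 / 2)
      (g ((x : UnitAddCircle) + (t : UnitAddCircle)) - g (x : UnitAddCircle)) : ℝ))
      =ᶠ[nhds 0] fun t => G (x + t) - G x := by
    have h3 : Set.Ico (-1 / 2 : ℝ) (-1 / 2 + 1) ∈ nhds (0 : ℝ) :=
      Ico_mem_nhds (by norm_num) (by norm_num)
    filter_upwards [h1 h3] with t ht
    have ht' : G (x + t) - G x ∈ Set.Ico (-1 / 2 : ℝ) (-1 / 2 + 1) := ht
    rw [← AddCircle.coe_add, ← h, ← h, ← AddCircle.coe_sub]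
    rw [AddCircle.equivIco_coe_eq ht']
  unfold circleDeriv
  rw [hev.deriv_eq, deriv_sub_const, deriv_comp_const_add]
  simp

/-- The rotation number can be computed from any lift. -/
theorem rotationNumber_eq {f : UnitAddCircle → UnitAddCircle} (F : CircleDeg1Liftˣ)
    (hF : IsLift F f) :
    rotationNumber f = ((F : CircleDeg1Lift).translationNumber : UnitAddCircle) := by
  have hex : ∃ G : CircleDeg1Liftˣ, IsLift G f := ⟨F, hF⟩
  unfold rotationNumber
  rw [dif_pos hex]
  generalize hGdef : hex.choose = G
  have hG : IsLift G f := hGdef ▸ hex.choose_spec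
  have cF : Continuous (F : ℝ → ℝ) := (CircleDeg1Lift.toOrderIso F).continuous
  have cG : Continuous (G : ℝ → ℝ) := (CircleDeg1Lift.toOrderIso G).continuous
  obtain ⟨k, hk⟩ : ∃ k : ℤ, (k : ℝ) = G 0 - F 0 := by
    have h0 : ((G 0 - F 0 : ℝ) : UnitAddCircle) = 0 := by
      rw [AddCircle.coe_sub, hG, hF, sub_self]
    obtain ⟨k, hk⟩ := (AddCircle.coe_eq_zero_iff (1 : ℝ)).1 h0
    exact ⟨k, by simpa using hk⟩
  have hkc : ((k : ℝ) : UnitAddCircle) = 0 :=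
    (AddCircle.coe_eq_zero_iff (1 : ℝ)).2 ⟨k, by simp⟩
  have hfun : (G : ℝ → ℝ) = fun x => (k : ℝ) + F x := by
    refine (AddCircle.isCoveringMap_coe (1 : ℝ)).eq_of_comp_eq cG (continuous_const.add cF)
      ?_ 0 (by simp [hk])
    funext x
    have hGx := hG x
    have hFx := hF x
    simp only [Function.comp_apply, AddCircle.coe_add]
    rw [hkc, zero_add, hGx, hFx]
  have hmul : (G : CircleDeg1Lift)
      = (CircleDeg1Lift.translate (Multiplicative.ofAdd (k : ℝ)) : CircleDeg1Lift) * F := by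
    ext x
    simpa using congrFun hfun x
  rw [hmul, CircleDeg1Lift.translationNumber_mul_of_commute,
    CircleDeg1Lift.translationNumber_translate, AddCircle.coe_add, hkc, zero_add]
  apply CircleDeg1Lift.ext
  intro x
  simp

end CircleDyn

end

/-! Let `G` be the lift of `f^{± q_n}`, corrected by an integer, that moves every point to the
right, by at most `M = M_n`. On the scale of its displacement `G` is nearly a parabolic Möbius map.
By `exists_abs_log_slope_le`, the log-slope of `F` over an interval is the mean of `φ = log DF` at
the endpoints, up to the square of the length. Along at most `2 q_{n+1}` iterates these squares sum
to `O(M)`, because the arcs `[F^i x, F^i (G x)]`, `i < q_{n+1}`, are disjoint on the circle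
(`sum_range_le_one`). Hence `G b - G a = (b - a) P(a) P(b) e^{O(M)}` with `P ^ 2 = DG`
(`AlmostMobius`), an identity that is exact for Möbius maps.

The cross-ratio of `x, G x, G² x, G³ x` is then nearly the squared trace. It is almost constant on
`[x, G x]` (`abs_log_orbitCrossRatio_sub_le`) and along orbits of `F`, and the arcs cover the circle
(`exists_iterate_le`), so it is almost constant. The extrema of the displacement force the constant
to be 4, up to `e^{O(M)}`.

With `v` the log-ratio of consecutive displacements, the cross-ratio is `(1 + e^{v(x)}) (1 + e^{-v(G
x)})`; extrema of `v` make it at least `4 + v²`, so `v = O(√M)`. This square is the source of the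
exponent 1/2. Finally `log P` is recovered from `v`. Denjoy's inequality (`abs_birkhoffSum_le`)
supplies the a priori bounds on `P`. -/

namespace CircleDyn

/-! ### Continued fractions and best approximation -/

section Convergents

lemma fract_pos_of_irrational {ξ : ℝ} (h : Irrational ξ) : 0 < Int.fract ξ :=
  lt_of_le_of_ne (Int.fract_nonneg ξ) fun h0 => h ⟨⌊ξ⌋, by
    have := Int.floor_add_fract ξ
    rw [← h0] at this
    simpa using this⟩

lemma irrational_inv_fract {ξ : ℝ} (h : Irrational ξ) : Irrational (Int.fract ξ)⁻¹ := by
  have : Irrational (Int.fract ξ) := by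
    rw [Int.fract]
    exact h.sub_intCast _
  exact this.inv

lemma one_lt_inv_fract {ξ : ℝ} (h : Irrational ξ) : 1 < (Int.fract ξ)⁻¹ :=
  (one_lt_inv₀ (fract_pos_of_irrational h)).2 (Int.fract_lt_one ξ)

lemma convergent_pos {ξ : ℝ} (h : Irrational ξ) (h1 : 1 < ξ) (n : ℕ) : 0 < ξ.convergent n := by
  have ha : (0 : ℚ) < ⌊ξ⌋ := by
    have : (1 : ℤ) ≤ ⌊ξ⌋ := Int.le_floor.2 (by simpa using h1.le)
    exact_mod_cast this
  induction n generalizing ξ with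
  | zero => simpa using ha
  | succ n ih =>
    rw [Real.convergent_succ]
    have h2 := one_lt_inv_fract h
    have h3 : (0 : ℚ) < ⌊(Int.fract ξ)⁻¹⌋ := by
      have : (1 : ℤ) ≤ ⌊(Int.fract ξ)⁻¹⌋ := Int.le_floor.2 (by simpa using h2.le)
      exact_mod_cast this
    have := ih (irrational_inv_fract h) h2 h3
    positivity

/-- `⌊ξ⌋ + 1 / (u / v) = (⌊ξ⌋ u + v) / u` is again in lowest terms. This is the Gauss-map recursion
behind the inductions below. -/
lemma convergent_succ_num_den {ξ : ℝ} (h : Irrational ξ) (n : ℕ) :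
    (ξ.convergent (n + 1)).num =
        ⌊ξ⌋ * ((Int.fract ξ)⁻¹.convergent n).num + ((Int.fract ξ)⁻¹.convergent n).den ∧
      ((ξ.convergent (n + 1)).den : ℤ) = ((Int.fract ξ)⁻¹.convergent n).num := by
  have hc := convergent_pos (irrational_inv_fract h) (one_lt_inv_fract h) n
  rw [Real.convergent_succ]
  set c := (Int.fract ξ)⁻¹.convergent n
  have hn : 0 < c.num := Rat.num_pos.2 hc
  have heq : (⌊ξ⌋ : ℚ) + c⁻¹ = ((⌊ξ⌋ * c.num + c.den : ℤ) : ℚ) / (c.num : ℚ) := by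
    have h0 : (c.num : ℚ) ≠ 0 := by exact_mod_cast hn.ne'
    conv_lhs => rw [← Rat.num_div_den c]
    push_cast
    field_simp
  have hcop : Nat.Coprime (⌊ξ⌋ * c.num + c.den : ℤ).natAbs c.num.natAbs := by
    have h1 : IsCoprime (c.den : ℤ) c.num := by
      rw [Int.isCoprime_iff_gcd_eq_one, Int.gcd_comm]
      simpa [Int.gcd] using c.reduced
    have h2 : IsCoprime (⌊ξ⌋ * c.num + c.den : ℤ) c.num := by
      rw [add_comm]
      exact IsCoprime.add_mul_right_left h1 _
    exact Int.isCoprime_iff_gcd_eq_one.1 h2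
  rw [heq]
  exact ⟨Rat.num_div_eq_of_coprime hn hcop, Rat.den_div_eq_of_coprime hn hcop⟩

/-- The signed error `q ξ - p` of the `n`-th convergent `p / q` of `ξ`. -/
noncomputable def convError (ξ : ℝ) (n : ℕ) : ℝ :=
  (ξ.convergent n).den * ξ - (ξ.convergent n).num

lemma convError_succ {ξ : ℝ} (h : Irrational ξ) (n : ℕ) :
    convError ξ (n + 1) = -Int.fract ξ * convError (Int.fract ξ)⁻¹ n := by
  obtain ⟨h1, h2⟩ := convergent_succ_num_den h n
  have h2' : ((ξ.convergent (n + 1)).den : ℝ) = ((Int.fract ξ)⁻¹.convergent n).num := by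
    exact_mod_cast h2
  have hf := (fract_pos_of_irrational h).ne'
  have hx : ξ = ⌊ξ⌋ + Int.fract ξ := (Int.floor_add_fract ξ).symm
  simp only [convError]
  rw [h1, h2']
  push_cast
  have : Int.fract ξ * (Int.fract ξ)⁻¹ = 1 := mul_inv_cancel₀ hf
  linear_combination ((Int.fract ξ)⁻¹.convergent n).num * hx +
    ((Int.fract ξ)⁻¹.convergent n).den * this

lemma convError_zero (ξ : ℝ) : convError ξ 0 = Int.fract ξ := by
  simp [convError]

lemma convError_sign {ξ : ℝ} (h : Irrational ξ) (n : ℕ) : 0 < (-1) ^ n * convError ξ n := by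
  induction n generalizing ξ with
  | zero => simpa [convError_zero] using fract_pos_of_irrational h
  | succ n ih =>
    rw [convError_succ h, pow_succ]
    have := mul_pos (fract_pos_of_irrational h) (ih (irrational_inv_fract h))
    linarith

lemma abs_convError_succ_lt {ξ : ℝ} (h : Irrational ξ) (n : ℕ) :
    |convError ξ (n + 1)| < |convError ξ n| := by
  have hf := fract_pos_of_irrational h
  induction n generalizing ξ with
  | zero =>
    rw [convError_succ h, convError_zero, convError_zero, abs_mul, abs_neg, abs_of_pos hf,
      abs_of_nonneg (Int.fract_nonneg _)]
    exact mul_lt_of_lt_one_right hf (Int.fract_lt_one _)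
  | succ n ih =>
    rw [convError_succ h, convError_succ h, abs_mul, abs_mul, abs_neg, abs_of_pos hf]
    exact mul_lt_mul_of_pos_left
      (ih (irrational_inv_fract h) (fract_pos_of_irrational (irrational_inv_fract h))) hf

lemma abs_convError_lt_one {ξ : ℝ} (h : Irrational ξ) (n : ℕ) : |convError ξ n| < 1 := by
  induction n with
  | zero =>
    rw [convError_zero, abs_of_nonneg (Int.fract_nonneg _)]
    exact Int.fract_lt_one _
  | succ n ih => exact (abs_convError_succ_lt h n).trans ih

lemma convergent_det {ξ : ℝ} (h : Irrational ξ) (n : ℕ) :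
    (ξ.convergent (n + 1)).num * (ξ.convergent n).den -
      (ξ.convergent n).num * (ξ.convergent (n + 1)).den = (-1) ^ n := by
  induction n generalizing ξ with
  | zero =>
    obtain ⟨h1, h2⟩ := convergent_succ_num_den h 0
    rw [h1, h2]
    simp
  | succ n ih =>
    obtain ⟨h1, h2⟩ := convergent_succ_num_den h n
    obtain ⟨h3, h4⟩ := convergent_succ_num_den h (n + 1)
    rw [h1, h2, h3, h4, pow_succ, ← ih (irrational_inv_fract h)]
    ring

/-- Numerators must be carried along: the denominators for `ξ` are the numerators for its Gauss
image, which exceeds 1. -/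
lemma convergent_num_den_mono {ξ : ℝ} (h : Irrational ξ) (n : ℕ) :
    (ξ.convergent n).den ≤ (ξ.convergent (n + 1)).den ∧
      (1 < ξ → (ξ.convergent n).num ≤ (ξ.convergent (n + 1)).num) := by
  induction n generalizing ξ with
  | zero =>
    refine ⟨?_, fun h1 => ?_⟩
    · rw [Real.convergent_zero, Rat.den_intCast]
      exact (ξ.convergent (0 + 1)).den_pos
    rw [(convergent_succ_num_den h 0).1]
    have hc := convergent_pos (irrational_inv_fract h) (one_lt_inv_fract h) 0
    have hn : 1 ≤ ((Int.fract ξ)⁻¹.convergent 0).num := Rat.num_pos.2 hc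
    have ha : 0 ≤ ⌊ξ⌋ := Int.floor_nonneg.2 (by linarith)
    have h0 : (ξ.convergent 0).num = ⌊ξ⌋ := by simp
    rw [h0]
    nlinarith
  | succ n ih =>
    obtain ⟨h1, h2⟩ := convergent_succ_num_den h n
    obtain ⟨h3, h4⟩ := convergent_succ_num_den h (n + 1)
    obtain ⟨i1, i2⟩ := ih (irrational_inv_fract h)
    have i3 := i2 (one_lt_inv_fract h)
    refine ⟨by zify; rw [h2, h4]; exact i3, fun hx => ?_⟩
    rw [h1, h3]
    have ha : 0 ≤ ⌊ξ⌋ := Int.floor_nonneg.2 (by linarith)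
    gcongr

/-- Convergents are best approximations of the second kind. -/
lemma abs_convError_le {ξ : ℝ} (h : Irrational ξ) (n : ℕ) {j : ℤ} (hj : j ≠ 0)
    (hjq : |j| < (ξ.convergent (n + 1)).den) (k : ℤ) : |convError ξ n| ≤ |j * ξ + k| := by
  have hdet := convergent_det h n
  have hs := convError_sign h n
  have hs' := convError_sign h (n + 1)
  obtain ⟨e, he⟩ : ∃ e : ℤ, e = (-1) ^ n := ⟨_, rfl⟩
  have he' : ((-1) ^ n : ℝ) = e := by rw [he]; push_cast; rfl
  have hee : e * e = 1 := by rw [he, ← mul_pow]; simp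
  rw [pow_succ] at hs'
  rw [he'] at hs hs'
  rw [← he] at hdet
  unfold convError at *
  set q := (ξ.convergent n).den
  set p := (ξ.convergent n).num
  set q' := (ξ.convergent (n + 1)).den with hq'
  set p' := (ξ.convergent (n + 1)).num
  have hq0 : 0 < (q : ℤ) := by exact_mod_cast (ξ.convergent n).den_pos
  have hq0' : 0 < (q' : ℤ) := by exact_mod_cast (ξ.convergent (n + 1)).den_pos
  -- `a` and `b` are the coordinates of `(j, -k)` in the basis `(q, p)`, `(q', p')`, unimodular by
  -- `convergent_det`.
  obtain ⟨a, ha⟩ : ∃ a : ℤ, a = e * (p' * j + k * q') := ⟨_, rfl⟩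
  obtain ⟨b, hb⟩ : ∃ b : ℤ, b = e * (-k * q - p * j) := ⟨_, rfl⟩
  have hj1 : j = a * q + b * q' := by
    rw [ha, hb]
    linear_combination (-j) * hee - j * e * hdet
  have hk1 : -k = a * p + b * p' := by
    rw [ha, hb]
    linear_combination k * hee + k * e * hdet
  have hx : (j * ξ + k : ℝ) = a * (q * ξ - p) + b * (q' * ξ - p') := by
    have hj2 : (j : ℝ) = a * q + b * q' := by exact_mod_cast hj1
    have hk2 : (-k : ℝ) = a * p + b * p' := by exact_mod_cast hk1
    linear_combination ξ * hj2 - hk2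
  have ha0 : a ≠ 0 := by
    rintro rfl
    rw [zero_mul, zero_add] at hj1
    have : b ≠ 0 := by rintro rfl; simp at hj1; exact hj hj1
    have h1 := Int.one_le_abs this
    rw [hj1, abs_mul, abs_of_pos hq0'] at hjq
    nlinarith
  have ha1 : (1 : ℝ) ≤ |(a : ℝ)| := by exact_mod_cast Int.one_le_abs ha0
  -- `|j| < q'` excludes `a`, `b` of equal sign; the two errors have opposite signs as well, so the
  -- terms in `hx` reinforce each other.
  have hab : a * b ≤ 0 := by
    by_contra! hc
    rw [abs_lt, hj1] at hjq
    rcases pos_and_pos_or_neg_and_neg_of_mul_pos hc with ⟨h1, h2⟩ | ⟨h1, h2⟩ <;> nlinarith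
  have hab' : (a * b : ℝ) ≤ 0 := by exact_mod_cast hab
  have hdd : (q * ξ - p : ℝ) * (q' * ξ - p') ≤ 0 := by
    have hee' : (e * e : ℝ) = 1 := by exact_mod_cast hee
    have := mul_pos hs hs'
    nlinarith
  rw [hx]
  calc |(q * ξ - p : ℝ)| ≤ |(a : ℝ)| * |(q * ξ - p : ℝ)| :=
        le_mul_of_one_le_left (abs_nonneg _) ha1
    _ = |a * (q * ξ - p : ℝ)| := (abs_mul _ _).symm
    _ ≤ |a * (q * ξ - p : ℝ) + b * (q' * ξ - p')| := by
        apply sq_le_sq.1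
        have : 0 ≤ (a * (q * ξ - p : ℝ)) * (b * (q' * ξ - p')) := by
          have := mul_nonneg_of_nonpos_of_nonpos hab' hdd
          linarith
        nlinarith [sq_nonneg (b * (q' * ξ - p' : ℝ))]

end Convergents

/-! ### Quadratic distortion of a smooth map -/

section Distortion

/-- If `f x = 0`, `f' x = 1` and `|f''| ≤ B` on `[x, y]`, then `|f y - (y - x)| ≤ B (y - x)²`. -/
lemma abs_sub_le_of_second_deriv {f f' f'' : ℝ → ℝ} {x y B : ℝ} (hxy : x ≤ y)
    (hf : ∀ t, HasDerivAt f (f' t) t) (hf' : ∀ t, HasDerivAt f' (f'' t) t)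
    (h0 : f x = 0) (h1 : f' x = 1) (hB : ∀ t ∈ Set.Icc x y, |f'' t| ≤ B) :
    |f y - (y - x)| ≤ B * (y - x) ^ 2 := by
  have key : ∀ t ∈ Set.Icc x y, |f' t - 1| ≤ B * (y - x) := by
    intro t ht
    have := (convex_Icc x y).norm_image_sub_le_of_norm_hasDerivWithin_le
      (f := f') (f' := f'') (C := B) (fun s _ => (hf' s).hasDerivWithinAt)
      (fun s hs => hB s hs) (Set.left_mem_Icc.2 hxy) ht
    rw [h1, Real.norm_eq_abs, Real.norm_eq_abs, abs_of_nonneg (sub_nonneg.2 ht.1)] at this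
    have hB0 : 0 ≤ B := (abs_nonneg _).trans (hB t ht)
    exact this.trans (mul_le_mul_of_nonneg_left (by linarith [ht.2]) hB0)
  have := (convex_Icc x y).norm_image_sub_le_of_norm_hasDerivWithin_le
    (f := fun t => f t - t) (f' := fun t => f' t - 1) (C := B * (y - x))
    (fun s _ => ((hf s).sub (hasDerivAt_id s)).hasDerivWithinAt)
    key (Set.left_mem_Icc.2 hxy) (Set.right_mem_Icc.2 hxy)
  rw [h0, Real.norm_eq_abs, Real.norm_eq_abs, abs_of_nonneg (sub_nonneg.2 hxy)] at this
  calc |f y - (y - x)| = |f y - y - (0 - x)| := by ring_nf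
    _ ≤ _ := this
    _ = _ := by ring

lemma abs_log_le {t c B : ℝ} (hc : 0 < c) (hc1 : c ≤ 1) (ht : c ≤ t) (hB : |t - 1| ≤ B) :
    |Real.log t| ≤ B / c := by
  have ht0 : 0 < t := hc.trans_le ht
  have hB0 : 0 ≤ B := (abs_nonneg _).trans hB
  rw [abs_le] at hB ⊢
  have h2 : B ≤ B / c := le_div_self hB0 hc hc1
  constructor
  · have h1 := Real.one_sub_inv_le_log_of_pos ht0
    have h3 : -(B / c) ≤ 1 - t⁻¹ := by
      have : 1 - t⁻¹ = (t - 1) / t := by field_simp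
      rw [this, ← neg_div, div_le_div_iff₀ hc ht0]
      nlinarith
    linarith
  · have h1 := Real.log_le_sub_one_of_pos ht0
    linarith

/-- A continuous periodic function is bounded. -/
lemma exists_abs_le_of_periodic {u : ℝ → ℝ} (hu : Continuous u) (hp : Function.Periodic u 1) :
    ∃ A : ℝ, 0 < A ∧ ∀ x, |u x| ≤ A := by
  obtain ⟨A, hA⟩ := isCompact_Icc.exists_bound_of_continuousOn (s := Set.Icc (0 : ℝ) 1)
    hu.continuousOn
  refine ⟨max A 1, by positivity, fun x => ?_⟩
  obtain ⟨y, hy, hxy⟩ := hp.exists_mem_Ico₀ one_pos x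
  rw [hxy]
  exact (hA y ⟨hy.1, hy.2.le⟩).trans (le_max_left _ _)

/-- A quadratic bound for the distortion of distances by a diffeomorphism with
derivative `e ^ φ`, where `φ` is periodic and of class `C²`. -/
lemma exists_abs_log_slope_le {F φ φ' φ'' : ℝ → ℝ}
    (hF : ∀ x, HasDerivAt F (Real.exp (φ x)) x) (hφ : ∀ x, HasDerivAt φ (φ' x) x)
    (hφ' : ∀ x, HasDerivAt φ' (φ'' x) x) (hc : Continuous φ'')
    (hp : Function.Periodic φ 1) (hp' : Function.Periodic φ' 1) (hp'' : Function.Periodic φ'' 1) :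
    ∃ K : ℝ, 0 < K ∧ ∀ x y, x < y →
      |Real.log ((F y - F x) / (y - x)) - (φ x + φ y) / 2| ≤ K * (y - x) ^ 2 := by
  obtain ⟨A, hA0, hA⟩ := exists_abs_le_of_periodic
    (continuous_iff_continuousAt.2 fun x => (hφ x).continuousAt) hp
  obtain ⟨A', hA0', hA'⟩ := exists_abs_le_of_periodic
    (continuous_iff_continuousAt.2 fun x => (hφ' x).continuousAt) hp'
  obtain ⟨A'', hA0'', hA''⟩ := exists_abs_le_of_periodic hc hp''
  set Q := A' ^ 2 + A'' with hQ
  -- The numerator bounds `E''` relative to `y - x`; the denominator is a lower bound for `E y / (y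
  -- - x)`, needed to pass to the logarithm.
  refine ⟨Q * Real.exp (2 * A) / Real.exp (-2 * A), by positivity, fun x y hxy => ?_⟩
  have hyx : 0 < y - x := sub_pos.2 hxy
  -- slope bounds
  have hslope : ∀ t, x < t → Real.exp (-A) * (t - x) ≤ F t - F x ∧
      F t - F x ≤ Real.exp A * (t - x) := by
    intro t ht
    obtain ⟨c, -, hc⟩ := exists_hasDerivAt_eq_slope F (fun s => Real.exp (φ s)) ht
      (fun s _ => (hF s).continuousAt.continuousWithinAt) (fun s _ => hF s)
    have ht' : 0 < t - x := sub_pos.2 ht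
    rw [eq_div_iff ht'.ne'] at hc
    have h1 := abs_le.1 (hA c)
    rw [← hc]
    exact ⟨by gcongr; exact h1.1, by gcongr; exact h1.2⟩
  -- `E'' = -(S/2) E` with `S = φ'' - φ'²/2` the Schwarzian derivative of `F`. Thus `E''` is as
  -- small as `E`, namely `O(y - x)`, and `E y / (y - x) = 1 + O((y - x)²)`.
  set E : ℝ → ℝ := fun t => (F t - F x) * Real.exp (-(φ x + φ t) / 2) with hE
  have hd1 : ∀ t, HasDerivAt (fun t => Real.exp (-(φ x + φ t) / 2))
      (Real.exp (-(φ x + φ t) / 2) * (-φ' t / 2)) t := fun t =>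
    (((hφ t).const_add (φ x)).neg.div_const 2).exp
  have hE1 : ∀ t, HasDerivAt E (Real.exp ((φ t - φ x) / 2) + E t * (-φ' t / 2)) t := by
    intro t
    refine (((hF t).sub_const (F x)).mul (hd1 t)).congr_deriv ?_
    rw [← Real.exp_add]
    simp only [hE]
    ring_nf
  have hE2 : ∀ t, HasDerivAt (fun t => Real.exp ((φ t - φ x) / 2) + E t * (-φ' t / 2))
      (E t * ((φ' t) ^ 2 / 4 - φ'' t / 2)) t := by
    intro t
    refine ((((hφ t).sub_const (φ x)).div_const 2).exp.add
      ((hE1 t).mul ((hφ' t).neg.div_const 2))).congr_deriv ?_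
    simp only [Pi.neg_apply]
    ring
  have hEb : ∀ t ∈ Set.Icc x y, |E t * ((φ' t) ^ 2 / 4 - φ'' t / 2)| ≤
      Q * Real.exp (2 * A) * (y - x) := by
    intro t ht
    have h1 : |E t| ≤ Real.exp (2 * A) * (y - x) := by
      rcases ht.1.eq_or_lt with rfl | htx
      · simp only [hE, sub_self, zero_mul, abs_zero]
        positivity
      · have h2 := hslope t htx
        have h3 : 0 ≤ F t - F x := le_trans (by have := sub_pos.2 htx; positivity) h2.1
        rw [abs_of_nonneg (by positivity)]
        have e1 : Real.exp (-(φ x + φ t) / 2) ≤ Real.exp A := by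
          gcongr
          linarith [(abs_le.1 (hA x)).1, (abs_le.1 (hA t)).1]
        calc E t ≤ (Real.exp A * (t - x)) * Real.exp A := by
              simp only [hE]
              gcongr
              exact h2.2
          _ = Real.exp (2 * A) * (t - x) := by
              rw [two_mul, Real.exp_add]; ring
          _ ≤ _ := by gcongr; exact ht.2
    have h2 : |(φ' t) ^ 2 / 4 - φ'' t / 2| ≤ Q := by
      have a1 := sq_abs (φ' t)
      have a2 := hA' t
      have a3 := abs_le.1 (hA'' t)
      have a4 : (φ' t) ^ 2 ≤ A' ^ 2 := by rw [← a1]; gcongr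
      rw [abs_le, hQ]
      constructor <;> nlinarith [sq_nonneg (φ' t)]
    rw [abs_mul]
    calc |E t| * |(φ' t) ^ 2 / 4 - φ'' t / 2| ≤ Real.exp (2 * A) * (y - x) * Q := by gcongr
      _ = _ := by ring
  have hmain := abs_sub_le_of_second_deriv hxy.le hE1 hE2 (by simp [hE]) (by simp [hE]) hEb
  have hlow := (hslope y hxy).1
  have hFpos : 0 < F y - F x := lt_of_lt_of_le (by positivity) hlow
  have hlog : Real.log ((F y - F x) / (y - x)) - (φ x + φ y) / 2 = Real.log (E y / (y - x)) := by
    have : E y / (y - x) = (F y - F x) / (y - x) * Real.exp (-(φ x + φ y) / 2) := by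
      simp only [hE]; ring
    rw [this, Real.log_mul (by positivity) (by positivity), Real.log_exp]
    ring
  rw [hlog]
  have hge : Real.exp (-2 * A) ≤ E y / (y - x) := by
    rw [le_div_iff₀ hyx]
    have e1 : Real.exp (-A) ≤ Real.exp (-(φ x + φ y) / 2) := by
      gcongr
      linarith [(abs_le.1 (hA x)).2, (abs_le.1 (hA y)).2]
    calc Real.exp (-2 * A) * (y - x) = (Real.exp (-A) * (y - x)) * Real.exp (-A) := by
          rw [show -2 * A = -A + -A by ring, Real.exp_add]; ring
      _ ≤ E y := by simp only [hE]; gcongr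
  have h1 : |E y / (y - x) - 1| ≤ Q * Real.exp (2 * A) * (y - x) ^ 2 := by
    have : E y / (y - x) - 1 = (E y - (y - x)) / (y - x) := by field_simp
    rw [this, abs_div, abs_of_pos hyx, div_le_iff₀ hyx]
    refine hmain.trans (le_of_eq ?_)
    ring
  refine (abs_log_le (Real.exp_pos _) ?_ hge h1).trans (le_of_eq ?_)
  · rw [Real.exp_le_one_iff]; linarith
  · ring

end Distortion

/-! ### Almost Möbius maps and their cross-ratios -/

section Projective

/-- The increasing map `G` without fixed points is, on the scale of its own displacement, close to
a Möbius map with derivative `P ^ 2`, with relative error `e ^ ε`. -/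
structure AlmostMobius (G P : ℝ → ℝ) (ε : ℝ) : Prop where
  strictMono : StrictMono G
  lt_map : ∀ x, x < G x
  pos : ∀ x, 0 < P x
  dist_map : ∀ a b, a < b → b ≤ G (G a) →
    ∃ θ, |θ| ≤ ε ∧ G b - G a = (b - a) * P a * P b * Real.exp θ

/-- The cross-ratio of four consecutive points of an orbit of `G`. -/
noncomputable def orbitCrossRatio (G : ℝ → ℝ) (x : ℝ) : ℝ :=
  ((G (G x) - x) * (G (G (G x)) - G x)) / ((G x - x) * (G (G (G x)) - G (G x)))

lemma abs_exp_sub_one_le_of_abs_le {θ s : ℝ} (h : |θ| ≤ s) :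
    |Real.exp θ - 1| ≤ Real.exp s - 1 := by
  obtain ⟨h1, h2⟩ := abs_le.1 h
  rw [abs_le]
  constructor
  · have e1 : Real.exp (-s) ≤ Real.exp θ := Real.exp_le_exp.2 h1
    have e2 := Real.add_one_le_exp (-s)
    have e3 : 0 < Real.exp s := Real.exp_pos s
    have e4 : Real.exp (-s) * Real.exp s = 1 := by rw [← Real.exp_add]; simp
    have e5 : 0 < Real.exp (-s) := Real.exp_pos _
    nlinarith [sq_nonneg (Real.exp s - 1), sq_nonneg (Real.exp (-s) - 1)]
  · have := Real.exp_le_exp.2 h2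
    linarith

lemma exp_sub_one_le_mul_exp {s B : ℝ} (h0 : 0 ≤ s) (h : s ≤ B) :
    Real.exp s - 1 ≤ s * Real.exp B := by
  have h1 := Real.add_one_le_exp (-s)
  have h2 : Real.exp (-s) * Real.exp s = 1 := by rw [← Real.exp_add]; simp
  have h3 : Real.exp s ≤ Real.exp B := Real.exp_le_exp.2 h
  have h4 := Real.exp_pos s
  nlinarith

lemma abs_log_sub_log_le_of_mul_exp {s t δ : ℝ} (hs : 0 < s) (ht : 0 < t)
    (h1 : s ≤ t * Real.exp δ) (h2 : t ≤ s * Real.exp δ) : |Real.log s - Real.log t| ≤ δ := by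
  have l1 := Real.log_le_log hs h1
  have l2 := Real.log_le_log ht h2
  rw [Real.log_mul ht.ne' (Real.exp_pos _).ne', Real.log_exp] at l1
  rw [Real.log_mul hs.ne' (Real.exp_pos _).ne', Real.log_exp] at l2
  rw [abs_le]
  constructor <;> linarith

lemma abs_log_sub_log_le_div {s t m B : ℝ} (hm : 0 < m) (hs : m ≤ s) (ht : m ≤ t)
    (h : |s - t| ≤ B) : |Real.log s - Real.log t| ≤ B / m := by
  have hs0 := hm.trans_le hs
  have ht0 := hm.trans_le ht
  obtain ⟨h1, h2⟩ := abs_le.1 h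
  have key : ∀ {u w : ℝ}, m ≤ w → 0 < u → u - w ≤ B → 0 ≤ B →
      Real.log u - Real.log w ≤ B / m := by
    intro u w hw hu huw hB
    have hw0 := hm.trans_le hw
    rw [← Real.log_div hu.ne' hw0.ne']
    have := Real.log_le_sub_one_of_pos (div_pos hu hw0)
    refine this.trans ?_
    have e : u / w - 1 = (u - w) / w := by field_simp
    rw [e, div_le_div_iff₀ hw0 hm]
    nlinarith
  have hB := (abs_nonneg _).trans h
  rw [abs_le]
  constructor
  · linarith [key hs ht0 (by linarith) hB]
  · exact key ht hs0 h2 hB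

/-- `a, b, c, u, w` stand for the gaps between `x, z, G x, G z, G² x, G² z`. Eliminating `c, u, w`
leaves a relation which, without the errors `θ`, reads `r₀ + 1 / r₁ = p₀ + 1 / p₁`. -/
lemma trace_relation {p₀ p₁ r₀ r₁ a b c u w θ₁ θ₂ θ₃ θ₄ θ₅ : ℝ}
    (P₀ : 0 < p₀) (P₁ : 0 < p₁) (R₀ : 0 < r₀) (R₁ : 0 < r₁)
    (hu : u = b * r₀ * p₁ * Real.exp θ₁) (hw : w = c * p₁ * r₁ * Real.exp θ₂)
    (huw : u + w = (b + c) * r₀ * r₁ * Real.exp θ₃) (hc : c = a * p₀ * r₀ * Real.exp θ₄)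
    (hcu : c + u = (a + b) * p₀ * p₁ * Real.exp θ₅) :
    b * Real.exp θ₁ / r₁ + a * p₀ * Real.exp (θ₄ + θ₂) + b * r₀ * Real.exp (θ₁ + θ₃) =
      b * Real.exp θ₃ / p₁ + (a + b) * p₀ * Real.exp (θ₅ + θ₃) := by
  have E1 : b * Real.exp θ₁ / r₁ + c * Real.exp θ₂ / r₀ = (b + c) * Real.exp θ₃ / p₁ := by
    rw [hu, hw] at huw
    field_simp
    linear_combination huw
  have E2 : c * Real.exp θ₃ / p₁ + b * r₀ * Real.exp (θ₁ + θ₃) =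
      (a + b) * p₀ * Real.exp (θ₅ + θ₃) := by
    rw [Real.exp_add, Real.exp_add]
    rw [hu] at hcu
    field_simp
    linear_combination hcu
  have E3 : c * Real.exp θ₂ / r₀ = a * p₀ * Real.exp (θ₄ + θ₂) := by
    rw [Real.exp_add, hc]
    field_simp
  rw [E3] at E1
  have E4 : (b + c) * Real.exp θ₃ / p₁ = b * Real.exp θ₃ / p₁ + c * Real.exp θ₃ / p₁ := by ring
  linear_combination E1 + E2 + E4

/-- The quantity `p₀ + 1 / p₁` is, for a Möbius map, the trace. -/
lemma abs_log_trace_sub_le {p₀ p₁ r₀ r₁ a b c u w κ V ε θ₁ θ₂ θ₃ θ₄ θ₅ : ℝ}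
    (hp₀ : Real.exp (-V) ≤ p₀) (hr₀ : Real.exp (-V) ≤ r₀)
    (hp₀' : p₀ ≤ Real.exp V) (hr₀' : r₀ ≤ Real.exp V)
    (hp₁ : Real.exp (-V) ≤ p₁) (hr₁ : Real.exp (-V) ≤ r₁)
    (ha : 0 < a) (hb : 0 < b) (hab : a ≤ κ * b) (h₁ : |θ₁| ≤ ε) (h₂ : |θ₂| ≤ ε) (h₃ : |θ₃| ≤ ε)
    (h₄ : |θ₄| ≤ ε) (h₅ : |θ₅| ≤ ε)
    (hu : u = b * r₀ * p₁ * Real.exp θ₁) (hw : w = c * p₁ * r₁ * Real.exp θ₂)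
    (huw : u + w = (b + c) * r₀ * r₁ * Real.exp θ₃) (hc : c = a * p₀ * r₀ * Real.exp θ₄)
    (hcu : c + u = (a + b) * p₀ * p₁ * Real.exp θ₅) :
    |Real.log (r₀ + 1 / r₁) - Real.log (p₀ + 1 / p₁)| ≤
      (Real.exp (2 * ε) - 1) * ((4 + 2 * κ) * Real.exp (2 * V)) := by
  have eV := Real.exp_pos (-V)
  have P₀ : 0 < p₀ := eV.trans_le hp₀
  have P₁ : 0 < p₁ := eV.trans_le hp₁
  have R₀ : 0 < r₀ := eV.trans_le hr₀
  have R₁ : 0 < r₁ := eV.trans_le hr₁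
  have ε0 : 0 ≤ ε := (abs_nonneg _).trans h₁
  obtain ⟨h₁₁, h₁₂⟩ := abs_le.1 h₁
  obtain ⟨h₂₁, h₂₂⟩ := abs_le.1 h₂
  obtain ⟨h₃₁, h₃₂⟩ := abs_le.1 h₃
  obtain ⟨h₄₁, h₄₂⟩ := abs_le.1 h₄
  obtain ⟨h₅₁, h₅₂⟩ := abs_le.1 h₅
  set η := Real.exp (2 * ε) - 1 with hη
  have hη0 : 0 ≤ η := by
    have := Real.add_one_le_exp (2 * ε)
    linarith
  have hrel := trace_relation P₀ P₁ R₀ R₁ hu hw huw hc hcu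
  have d : ∀ {θ k : ℝ}, |θ| ≤ 2 * ε → 0 ≤ k → |k * Real.exp θ - k| ≤ k * η := by
    intro θ k h hk
    rw [show k * Real.exp θ - k = k * (Real.exp θ - 1) by ring, abs_mul, abs_of_nonneg hk]
    exact mul_le_mul_of_nonneg_left (abs_exp_sub_one_le_of_abs_le h) hk
  have d1 := d (θ := θ₁) (k := b / r₁) (abs_le.2 ⟨by linarith, by linarith⟩) (by positivity)
  have d2 := d (θ := θ₄ + θ₂) (k := a * p₀) (abs_le.2 ⟨by linarith, by linarith⟩) (by positivity)
  have d3 := d (θ := θ₁ + θ₃) (k := b * r₀) (abs_le.2 ⟨by linarith, by linarith⟩) (by positivity)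
  have d4 := d (θ := θ₃) (k := b / p₁) (abs_le.2 ⟨by linarith, by linarith⟩) (by positivity)
  have d5 := d (θ := θ₅ + θ₃) (k := (a + b) * p₀) (abs_le.2 ⟨by linarith, by linarith⟩)
    (by positivity)
  rw [show b / r₁ * Real.exp θ₁ = b * Real.exp θ₁ / r₁ by ring] at d1
  rw [show b / p₁ * Real.exp θ₃ = b * Real.exp θ₃ / p₁ by ring] at d4
  rw [abs_le] at d1 d2 d3 d4 d5
  have i1 : 1 / r₁ ≤ Real.exp V := by
    rw [div_le_iff₀ R₁]
    calc 1 = Real.exp V * Real.exp (-V) := by rw [← Real.exp_add]; simp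
      _ ≤ _ := by gcongr
  have i2 : 1 / p₁ ≤ Real.exp V := by
    rw [div_le_iff₀ P₁]
    calc 1 = Real.exp V * Real.exp (-V) := by rw [← Real.exp_add]; simp
      _ ≤ _ := by gcongr
  -- The errors contain terms of size `a`, while the trace difference comes multiplied by `b`; hence
  -- the need for `hab`.
  have hsum : b / r₁ + a * p₀ + b * r₀ + b / p₁ + (a + b) * p₀ ≤
      b * ((4 + 2 * κ) * Real.exp V) := by
    have j1 : b / r₁ ≤ b * Real.exp V := by
      rw [div_eq_mul_one_div]; gcongr
    have j2 : b / p₁ ≤ b * Real.exp V := by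
      rw [div_eq_mul_one_div]; gcongr
    have j3 : b * r₀ ≤ b * Real.exp V := by gcongr
    have j4 : b * p₀ ≤ b * Real.exp V := by gcongr
    have j5 : a * p₀ ≤ (κ * b) * Real.exp V := by gcongr; exact ha.le.trans hab
    linarith
  have hdiff : |(r₀ + 1 / r₁) - (p₀ + 1 / p₁)| ≤ η * ((4 + 2 * κ) * Real.exp V) := by
    have hb' : b * |(r₀ + 1 / r₁) - (p₀ + 1 / p₁)| ≤
        η * (b / r₁ + a * p₀ + b * r₀ + b / p₁ + (a + b) * p₀) := by
      rw [← abs_of_pos hb, ← abs_mul, abs_of_pos hb]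
      have e : b * ((r₀ + 1 / r₁) - (p₀ + 1 / p₁)) =
          b / r₁ + a * p₀ + b * r₀ - b / p₁ - (a + b) * p₀ := by ring
      rw [e, abs_le]
      constructor <;> linarith
    refine le_of_mul_le_mul_left ((hb'.trans (mul_le_mul_of_nonneg_left hsum hη0)).trans
      (le_of_eq ?_)) hb
    ring
  have k1 : Real.exp (-V) ≤ r₀ + 1 / r₁ := by
    have : 0 < 1 / r₁ := by positivity
    linarith
  have k2 : Real.exp (-V) ≤ p₀ + 1 / p₁ := by
    have : 0 < 1 / p₁ := by positivity
    linarith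
  refine (abs_log_sub_log_le_div eV k1 k2 hdiff).trans (le_of_eq ?_)
  rw [Real.exp_neg, div_inv_eq_mul, two_mul V, Real.exp_add]
  ring

namespace AlmostMobius

variable {G P : ℝ → ℝ} {ε : ℝ}

lemma orbitCrossRatio_pos (h : AlmostMobius G P ε) (x : ℝ) : 0 < orbitCrossRatio G x := by
  have h0 := sub_pos.2 (h.lt_map x)
  have h1 := sub_pos.2 (h.lt_map (G x))
  have h2 := sub_pos.2 (h.lt_map (G (G x)))
  have h3 : 0 < G (G x) - x := by linarith
  have h4 : 0 < G (G (G x)) - G x := by linarith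
  unfold orbitCrossRatio
  positivity

/-- Each value of `P` occurs once above and once below the fraction bar, so only four errors
survive. -/
lemma abs_log_orbitCrossRatio_map_sub_le (h : AlmostMobius G P ε) (x : ℝ) :
    |Real.log (orbitCrossRatio G (G x)) - Real.log (orbitCrossRatio G x)| ≤ 4 * ε := by
  have h0 := h.lt_map x
  have h1 := h.lt_map (G x)
  have h2 := h.lt_map (G (G x))
  have P0 := h.pos x
  have P1 := h.pos (G x)
  have P2 := h.pos (G (G x))
  have P3 := h.pos (G (G (G x)))
  obtain ⟨θ₁, t₁, e₁⟩ := h.dist_map x (G x) h0 h1.le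
  obtain ⟨θ₂, t₂, e₂⟩ := h.dist_map x (G (G x)) (h0.trans h1) le_rfl
  obtain ⟨θ₃, t₃, e₃⟩ := h.dist_map (G x) (G (G (G x))) (h1.trans h2) le_rfl
  obtain ⟨θ₄, t₄, e₄⟩ := h.dist_map (G (G x)) (G (G (G x))) h2 (h.lt_map _).le
  have key : orbitCrossRatio G (G x) = orbitCrossRatio G x * Real.exp (θ₂ + θ₃ - θ₁ - θ₄) := by
    have s0 := (sub_pos.2 h0).ne'
    have s1 := (sub_pos.2 h2).ne'
    unfold orbitCrossRatio
    rw [e₁, e₂, e₃, e₄, Real.exp_sub, Real.exp_sub, Real.exp_add]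
    field_simp
    linear_combination (G (G x) - x) * e₂
  rw [key, Real.log_mul (h.orbitCrossRatio_pos x).ne' (Real.exp_pos _).ne', Real.log_exp]
  rw [abs_le] at *
  constructor <;> linarith

/-- Up to errors, `G (G x) - x = (G x - x) * P (G x) * (P x + 1 / P (G x))`, which makes the
cross-ratio the square of the trace. -/
lemma abs_log_orbitCrossRatio_sub_log_trace_le (h : AlmostMobius G P ε) (x : ℝ) :
    |Real.log (orbitCrossRatio G x) - 2 * Real.log (P x + 1 / P (G x))| ≤ 5 * ε := by
  have h0 := h.lt_map x
  have h1 := h.lt_map (G x)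
  have h2 := h.lt_map (G (G x))
  have P0 := h.pos x
  have P1 := h.pos (G x)
  have P2 := h.pos (G (G x))
  obtain ⟨θ₁, t₁, e₁⟩ := h.dist_map x (G x) h0 h1.le
  obtain ⟨θ₂, t₂, e₂⟩ := h.dist_map x (G (G x)) (h0.trans h1) le_rfl
  obtain ⟨θ₃, t₃, e₃⟩ := h.dist_map (G x) (G (G x)) h1 h2.le
  set s := P x * Real.exp θ₁ + 1 / P (G x) with hs
  have hs0 : 0 < s := by positivity
  have key : orbitCrossRatio G x = s ^ 2 * Real.exp (θ₂ - θ₁ - θ₃) := by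
    have s0 := (sub_pos.2 h0).ne'
    have e : G (G x) - x = (G x - x) * P (G x) * s := by
      rw [hs]
      field_simp
      linarith
    unfold orbitCrossRatio
    rw [e₃, e₂, e₁, e, Real.exp_sub, Real.exp_sub]
    field_simp
  have hst : |Real.log s - Real.log (P x + 1 / P (G x))| ≤ ε := by
    obtain ⟨t1, t2⟩ := abs_le.1 t₁
    have ε0 : 0 ≤ ε := (abs_nonneg _).trans t₁
    have i1 : 1 ≤ Real.exp ε := Real.one_le_exp ε0
    have i2 : Real.exp θ₁ ≤ Real.exp ε := Real.exp_le_exp.2 t2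
    have i3 : 1 ≤ Real.exp θ₁ * Real.exp ε := by
      rw [← Real.exp_add]; exact Real.one_le_exp (by linarith)
    have i4 : 0 < 1 / P (G x) := by positivity
    apply abs_log_sub_log_le_of_mul_exp hs0 (by positivity)
    · rw [hs]; nlinarith
    · rw [hs]; nlinarith
  rw [key, Real.log_mul (by positivity) (Real.exp_pos _).ne', Real.log_exp, Real.log_pow]
  rw [abs_le] at *
  push_cast
  constructor <;> linarith

lemma abs_log_orbitCrossRatio_sub_le_of_le {V κ : ℝ} (h : AlmostMobius G P ε)
    (hP : ∀ x, Real.exp (-V) ≤ P x ∧ P x ≤ Real.exp V) {x z : ℝ}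
    (hxz : x < z) (hz : z < G x) (hκ : z - x ≤ κ * (G x - z)) :
    |Real.log (orbitCrossRatio G z) - Real.log (orbitCrossRatio G x)| ≤
      2 * ((Real.exp (2 * ε) - 1) * ((4 + 2 * κ) * Real.exp (2 * V))) + 10 * ε := by
  have hz1 := h.strictMono hxz
  have hz2 := h.strictMono hz
  have hz3 := h.strictMono hz1
  have hx1 := h.lt_map (G x)
  obtain ⟨θ₁, t₁, e₁⟩ := h.dist_map z (G x) hz (by linarith)
  obtain ⟨θ₂, t₂, e₂⟩ := h.dist_map (G x) (G z) hz1 (by linarith [h.lt_map (G (G x))])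
  obtain ⟨θ₃, t₃, e₃⟩ := h.dist_map z (G z) (h.lt_map z) (h.lt_map _).le
  obtain ⟨θ₄, t₄, e₄⟩ := h.dist_map x z hxz (by linarith)
  obtain ⟨θ₅, t₅, e₅⟩ := h.dist_map x (G x) (h.lt_map x) (h.lt_map _).le
  have := abs_log_trace_sub_le (p₀ := P x) (p₁ := P (G x)) (r₀ := P z) (r₁ := P (G z))
    (hP _).1 (hP _).1 (hP _).2 (hP _).2 (hP _).1 (hP _).1
    (sub_pos.2 hxz) (sub_pos.2 hz) hκ t₁ t₂ t₃ t₄ t₅ e₁ e₂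
    (by linear_combination e₃) e₄ (by linear_combination e₅)
  have a1 := h.abs_log_orbitCrossRatio_sub_log_trace_le x
  have a2 := h.abs_log_orbitCrossRatio_sub_log_trace_le z
  rw [abs_le] at *
  constructor <;> linarith

/-- The previous comparison degenerates as `z` approaches `G x`. For `z` in the right half of `[x, G
x]` it is applied to `z < G x < G z` instead, and passing from `G x` to `x` costs the extra `4 * ε`.
-/
lemma abs_log_orbitCrossRatio_sub_le {V : ℝ} (h : AlmostMobius G P ε) (hV : 0 ≤ V)
    (hP : ∀ x, Real.exp (-V) ≤ P x ∧ P x ≤ Real.exp V) {x z : ℝ}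
    (hxz : x ≤ z) (hz : z ≤ G x) :
    |Real.log (orbitCrossRatio G z) - Real.log (orbitCrossRatio G x)| ≤
      2 * ((Real.exp (2 * ε) - 1) * ((4 + 2 * Real.exp (2 * V + ε)) * Real.exp (2 * V))) +
        14 * ε := by
  have hGx := h.abs_log_orbitCrossRatio_map_sub_le x
  have ε0 : 0 ≤ ε := by linarith [(abs_nonneg _).trans hGx]
  have hη : 0 ≤ Real.exp (2 * ε) - 1 := by
    have := Real.add_one_le_exp (2 * ε)
    linarith
  have hT : 0 ≤ 2 * ((Real.exp (2 * ε) - 1) *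
      ((4 + 2 * Real.exp (2 * V + ε)) * Real.exp (2 * V))) := by positivity
  rcases hxz.eq_or_lt with rfl | hxz
  · simp only [sub_self, abs_zero]
    linarith
  rcases hz.eq_or_lt with rfl | hz
  · linarith
  rcases le_total (z - x) (G x - z) with hc | hc
  · have hκ : z - x ≤ Real.exp (2 * V + ε) * (G x - z) :=
      hc.trans (le_mul_of_one_le_left (sub_pos.2 hz).le (Real.one_le_exp (by positivity)))
    have := h.abs_log_orbitCrossRatio_sub_le_of_le hP hxz hz hκ
    linarith
  · obtain ⟨θ, t, e⟩ := h.dist_map x z hxz (by linarith [h.lt_map (G x)])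
    have hκ : G x - z ≤ Real.exp (2 * V + ε) * (G z - G x) := by
      have h1 : Real.exp (-V) * Real.exp (-V) * Real.exp (-ε) ≤ P x * P z * Real.exp θ := by
        have := (abs_le.1 t).1
        have := h.pos x
        have := h.pos z
        gcongr
        · exact (hP x).1
        · exact (hP z).1
      have h2 : Real.exp (2 * V + ε) * (Real.exp (-V) * Real.exp (-V) * Real.exp (-ε)) = 1 := by
        rw [← Real.exp_add, ← Real.exp_add, ← Real.exp_add]
        ring_nf
        simp
      have h3 : 0 < z - x := sub_pos.2 hxz
      have h4 := Real.exp_pos (2 * V + ε)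
      calc G x - z ≤ (z - x) * (Real.exp (2 * V + ε) *
            (Real.exp (-V) * Real.exp (-V) * Real.exp (-ε))) := by rw [h2]; linarith
        _ ≤ (z - x) * (Real.exp (2 * V + ε) * (P x * P z * Real.exp θ)) := by gcongr
        _ = _ := by rw [e]; ring
    have := h.abs_log_orbitCrossRatio_sub_le_of_le hP hz (h.strictMono hxz) hκ
    rw [abs_le] at *
    constructor <;> linarith

end AlmostMobius

lemma exists_forall_le_of_periodic {u : ℝ → ℝ} (hu : Continuous u) (hp : Function.Periodic u 1) :
    ∃ m, ∀ x, u x ≤ u m := by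
  obtain ⟨m, -, hm⟩ := isCompact_Icc.exists_isMaxOn (s := Set.Icc (0 : ℝ) 1)
    ⟨0, by simp⟩ hu.continuousOn
  refine ⟨m, fun x => ?_⟩
  obtain ⟨y, hy, hxy⟩ := hp.exists_mem_Ico₀ one_pos x
  rw [hxy]
  exact hm ⟨hy.1, hy.2.le⟩

/-- By monotonicity in `s` and `t` it suffices that `(1 + e^r)(1 + e^{-r}) = 2 + 2 cosh r ≥ 4 + r²`.
The choice `r = s` serves a maximum of `logRatio`, `r = t` a minimum. -/
lemma four_add_sq_le {s t : ℝ} (hts : t ≤ s) {r : ℝ} (hr : r = s ∨ r = t) :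
    4 + r ^ 2 ≤ (1 + Real.exp s) * (1 + Real.exp (-t)) := by
  have hcosh : 1 + r ^ 2 / 2 ≤ Real.cosh r := by
    have h1 : Real.cosh r = 2 * Real.sinh (r / 2) ^ 2 + 1 := by
      have := Real.cosh_two_mul (r / 2)
      rw [Real.cosh_sq] at this
      rw [show 2 * (r / 2) = r by ring] at this
      linarith
    have h2 : (r / 2) ^ 2 ≤ Real.sinh (r / 2) ^ 2 := by
      rw [sq_le_sq, Real.abs_sinh]
      exact Real.self_le_sinh_iff.2 (abs_nonneg _)
    rw [h1]
    nlinarith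
  have h3 : (1 + Real.exp r) * (1 + Real.exp (-r)) = 2 + 2 * Real.cosh r := by
    have : Real.exp r * Real.exp (-r) = 1 := by rw [← Real.exp_add]; simp
    rw [Real.cosh_eq]
    linear_combination this
  have h4 : (1 + Real.exp r) * (1 + Real.exp (-r)) ≤ (1 + Real.exp s) * (1 + Real.exp (-t)) := by
    rcases hr with rfl | rfl <;> gcongr
  linarith

lemma abs_log_one_add_exp_sub_le (s t : ℝ) :
    |Real.log (1 + Real.exp s) - Real.log (1 + Real.exp t)| ≤ |s - t| := by
  have key : ∀ a b : ℝ, 1 + Real.exp a ≤ (1 + Real.exp b) * Real.exp |a - b| := by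
    intro a b
    have h1 : Real.exp a ≤ Real.exp b * Real.exp |a - b| := by
      rw [← Real.exp_add]
      exact Real.exp_le_exp.2 (by linarith [le_abs_self (a - b)])
    have h2 : 1 ≤ Real.exp |a - b| := Real.one_le_exp (abs_nonneg _)
    linarith
  apply abs_log_sub_log_le_of_mul_exp (by positivity) (by positivity) (key s t)
  rw [abs_sub_comm]
  exact key t s

/-- The logarithm of the ratio of consecutive displacements of `G`. -/
noncomputable def logRatio (G : ℝ → ℝ) (x : ℝ) : ℝ := Real.log ((G (G x) - G x) / (G x - x))

namespace AlmostMobius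

variable {G P : ℝ → ℝ} {ε : ℝ}

lemma exp_logRatio (h : AlmostMobius G P ε) (x : ℝ) :
    Real.exp (logRatio G x) = (G (G x) - G x) / (G x - x) :=
  Real.exp_log (div_pos (sub_pos.2 (h.lt_map _)) (sub_pos.2 (h.lt_map _)))

lemma orbitCrossRatio_eq (h : AlmostMobius G P ε) (x : ℝ) :
    orbitCrossRatio G x =
      (1 + Real.exp (logRatio G x)) * (1 + Real.exp (-logRatio G (G x))) := by
  have h0 := (sub_pos.2 (h.lt_map x)).ne'
  have h1 := (sub_pos.2 (h.lt_map (G x))).ne'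
  have h2 := (sub_pos.2 (h.lt_map (G (G x)))).ne'
  rw [Real.exp_neg, h.exp_logRatio, h.exp_logRatio]
  unfold orbitCrossRatio
  field_simp
  ring

/-- For consecutive displacements `d₀, d₁, d₂` the cross-ratio is `(d₀ + d₁)(d₁ + d₂) / (d₀ d₂)`: at
least 4 if `d₁` is the largest displacement, at most 4 if it is the smallest. The extremal points
are written `G m`, `G k` to put them in the middle. -/
lemma abs_log_orbitCrossRatio_sub_log_four_le (h : AlmostMobius G P ε) (hc : Continuous G)
    (hs : Function.Surjective G) (hp : ∀ x, G (x + 1) = G x + 1) {δ : ℝ}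
    (hδ : ∀ x z, |Real.log (orbitCrossRatio G x) - Real.log (orbitCrossRatio G z)| ≤ δ) (x : ℝ) :
    |Real.log (orbitCrossRatio G x) - Real.log 4| ≤ δ := by
  have hper : Function.Periodic (fun x => G x - x) 1 := fun x => by simp only [hp]; ring
  have hcont : Continuous fun x => G x - x := hc.sub continuous_id
  have hpos : ∀ m, 0 < (G m - m) * (G (G (G m)) - G (G m)) := fun m =>
    mul_pos (sub_pos.2 (h.lt_map _)) (sub_pos.2 (h.lt_map _))
  obtain ⟨m', hm⟩ := exists_forall_le_of_periodic hcont hper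
  obtain ⟨m, rfl⟩ := hs m'
  obtain ⟨k', hk⟩ := exists_forall_le_of_periodic (u := fun x => -(G x - x)) hcont.neg
    (fun x => by simp only [hper x])
  obtain ⟨k, rfl⟩ := hs k'
  have hmax : 4 ≤ orbitCrossRatio G m := by
    unfold orbitCrossRatio
    rw [le_div_iff₀ (hpos m)]
    nlinarith [hm m, hm (G (G m)), h.lt_map m, h.lt_map (G (G m)), h.lt_map (G m)]
  have hmin : orbitCrossRatio G k ≤ 4 := by
    unfold orbitCrossRatio
    rw [div_le_iff₀ (hpos k)]
    have a1 := hk k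
    have a2 := hk (G (G k))
    nlinarith [h.lt_map k, h.lt_map (G (G k)), h.lt_map (G k)]
  have l1 := Real.log_le_log (by norm_num) hmax
  have l2 := Real.log_le_log (h.orbitCrossRatio_pos k) hmin
  have w1 := abs_le.1 (hδ x m)
  have w2 := abs_le.1 (hδ x k)
  rw [abs_le]
  constructor <;> linarith

/-- At a maximum `m`, or one step before a minimum `G k`, `logRatio` does not increase under `G`;
`four_add_sq_le` then squeezes its square between the cross-ratio and 4. -/
lemma logRatio_sq_le (h : AlmostMobius G P ε) (hc : Continuous G)
    (hs : Function.Surjective G) (hp : ∀ x, G (x + 1) = G x + 1) {δ : ℝ}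
    (hδ : ∀ x, |Real.log (orbitCrossRatio G x) - Real.log 4| ≤ δ) (x : ℝ) :
    logRatio G x ^ 2 ≤ 4 * (Real.exp δ - 1) := by
  have hle : ∀ x, orbitCrossRatio G x ≤ 4 * Real.exp δ := by
    intro x
    have h1 := (abs_le.1 (hδ x)).2
    rw [← Real.exp_log (h.orbitCrossRatio_pos x)]
    calc Real.exp (Real.log (orbitCrossRatio G x)) ≤ Real.exp (Real.log 4 + δ) :=
          Real.exp_le_exp.2 (by linarith)
      _ = _ := by rw [Real.exp_add, Real.exp_log (by norm_num)]
  have hcont : Continuous (logRatio G) := by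
    unfold logRatio
    refine Continuous.log (Continuous.div (by fun_prop) (by fun_prop) fun x => ?_) fun x => ?_
    · exact (sub_pos.2 (h.lt_map _)).ne'
    · exact (div_pos (sub_pos.2 (h.lt_map _)) (sub_pos.2 (h.lt_map _))).ne'
  have hper : Function.Periodic (logRatio G) 1 := fun x => by
    unfold logRatio
    simp only [hp]
    congr 2 <;> ring
  obtain ⟨m, hm⟩ := exists_forall_le_of_periodic hcont hper
  obtain ⟨k', hk⟩ := exists_forall_le_of_periodic (u := fun x => -logRatio G x) hcont.neg
    (fun x => by simp only [hper x])
  obtain ⟨k, rfl⟩ := hs k'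
  have i1 : logRatio G m ^ 2 ≤ 4 * (Real.exp δ - 1) := by
    have := four_add_sq_le (hm (G m)) (r := logRatio G m) (Or.inl rfl)
    rw [← h.orbitCrossRatio_eq] at this
    linarith [hle m]
  have i2 : logRatio G (G k) ^ 2 ≤ 4 * (Real.exp δ - 1) := by
    have := four_add_sq_le (neg_le_neg_iff.1 (hk k)) (r := logRatio G (G k)) (Or.inr rfl)
    rw [← h.orbitCrossRatio_eq] at this
    linarith [hle k]
  have j1 := hm x
  have j2 := neg_le_neg_iff.1 (hk x)
  rcases le_total 0 (logRatio G x) with h0 | h0 <;> nlinarith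

/-- The slopes of `G` over `[x, G x]`, `[G x, G² x]` and `[x, G² x]` approximate the pairwise sums
of `log P` at the three points; the linear system is solved for `2 log P(x)`. All three slopes are
expressed through `logRatio`. -/
lemma abs_log_le_of_logRatio (h : AlmostMobius G P ε) {W : ℝ}
    (hW : ∀ x, |logRatio G x| ≤ W) (x : ℝ) : |Real.log (P x)| ≤ (3 * ε + 5 * W) / 2 := by
  have h0 := h.lt_map x
  have h1 := h.lt_map (G x)
  have h2 := h.lt_map (G (G x))
  have hd : ∀ a b, a < b → b ≤ G (G a) →
      |Real.log (P a) + Real.log (P b) - Real.log ((G b - G a) / (b - a))| ≤ ε := by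
    intro a b hab hb
    obtain ⟨θ, t, e⟩ := h.dist_map a b hab hb
    have : (G b - G a) / (b - a) = P a * P b * Real.exp θ := by
      rw [e]
      have := (sub_pos.2 hab).ne'
      field_simp
    have pa := h.pos a
    have pb := h.pos b
    rw [this, Real.log_mul (by positivity) (by positivity), Real.log_mul pa.ne' pb.ne',
      Real.log_exp, show Real.log (P a) + Real.log (P b) - (Real.log (P a) + Real.log (P b) + θ)
        = -θ by ring, abs_neg]
    exact t
  have e1 := hd x (G x) h0 h1.le
  have e2 := hd (G x) (G (G x)) h1 h2.le
  have e3 := hd x (G (G x)) (h0.trans h1) le_rfl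
  have e4 : Real.log ((G (G (G x)) - G x) / (G (G x) - x)) =
      logRatio G x + (Real.log (1 + Real.exp (logRatio G (G x))) -
        Real.log (1 + Real.exp (logRatio G x))) := by
    have s0 := sub_pos.2 h0
    have s1 := sub_pos.2 h1
    have s2 := sub_pos.2 h2
    have s3 : 0 < G (G x) - x := by linarith
    rw [← Real.log_div (by positivity) (by positivity), h.exp_logRatio, h.exp_logRatio, logRatio,
      ← Real.log_mul (by positivity)]
    · congr 1
      have : 1 + (G (G x) - G x) / (G x - x) = (G (G x) - x) / (G x - x) := by
        field_simp; ring
      rw [this]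
      field_simp
      ring
    · positivity
  have e5 := abs_log_one_add_exp_sub_le (logRatio G (G x)) (logRatio G x)
  have w0 := hW x
  have w1 := hW (G x)
  have e6 := e5.trans (abs_sub _ _)
  change |_ - logRatio G x| ≤ ε at e1
  change |_ - logRatio G (G x)| ≤ ε at e2
  rw [e4] at e3
  have e7 := e6.trans (add_le_add w1 w0)
  rw [abs_le] at e1 e2 e3 e7 w0 w1 ⊢
  constructor <;> linarith

end AlmostMobius

/-- If an almost Möbius map `G` of derivative `P ^ 2` with relative error `e ^ ε` has a cross-ratio
`orbitCrossRatio G` which is constant up to `e ^ ε` on orbits that meet every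
interval `[G⁻¹ z, z]`, then `log P = O(√ε)`. -/
theorem exists_abs_log_le_sqrt {V E : ℝ} (hV : 0 ≤ V) :
    ∃ C : ℝ, 0 ≤ C ∧ ∀ (G P : ℝ → ℝ) (ε : ℝ), ε ≤ E → AlmostMobius G P ε →
      (∀ x, Real.exp (-V) ≤ P x ∧ P x ≤ Real.exp V) → Continuous G → Function.Surjective G →
      (∀ x, G (x + 1) = G x + 1) →
      (∀ x z, ∃ y, y ≤ z ∧ z ≤ G y ∧
        |Real.log (orbitCrossRatio G y) - Real.log (orbitCrossRatio G x)| ≤ ε) →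
      ∀ x, |Real.log (P x)| ≤ C * Real.sqrt ε := by
  -- The bound of `abs_log_orbitCrossRatio_sub_le` linearised for `ε ≤ E`; in 15, 14 comes from that
  -- lemma and 1 from transport along the orbit.
  set A := 2 * (2 * Real.exp (2 * E) * ((4 + 2 * Real.exp (2 * V + E)) * Real.exp (2 * V))) + 15
    with hA
  have hA0 : 0 ≤ A := by positivity
  refine ⟨(3 * Real.sqrt E + 5 * Real.sqrt (4 * (A * Real.exp (A * E)))) / 2, by positivity,
    fun G P ε hεE h hP hc hs hp hcov x => ?_⟩
  have ε0 : 0 ≤ ε := by linarith [(abs_nonneg _).trans (h.abs_log_orbitCrossRatio_map_sub_le 0)]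
  have hδ : ∀ x z, |Real.log (orbitCrossRatio G x) - Real.log (orbitCrossRatio G z)| ≤ A * ε := by
    intro x z
    obtain ⟨y, hyz, hzy, hy⟩ := hcov x z
    have h1 := h.abs_log_orbitCrossRatio_sub_le hV hP hyz hzy
    have h2 : 2 * ((Real.exp (2 * ε) - 1) * ((4 + 2 * Real.exp (2 * V + ε)) * Real.exp (2 * V))) ≤
        2 * ((2 * ε * Real.exp (2 * E)) *
          ((4 + 2 * Real.exp (2 * V + E)) * Real.exp (2 * V))) := by
      gcongr
      exact exp_sub_one_le_mul_exp (by positivity) (by linarith)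
    have h3 : A * ε = 2 * ((2 * ε * Real.exp (2 * E)) *
        ((4 + 2 * Real.exp (2 * V + E)) * Real.exp (2 * V))) + 15 * ε := by rw [hA]; ring
    rw [h3]
    rw [abs_le] at *
    constructor <;> linarith
  have hv : ∀ x, |logRatio G x| ≤ Real.sqrt (4 * (A * Real.exp (A * E))) * Real.sqrt ε := by
    intro x
    rw [← Real.sqrt_mul (by positivity)]
    apply Real.abs_le_sqrt
    refine (h.logRatio_sq_le hc hs hp
      (h.abs_log_orbitCrossRatio_sub_log_four_le hc hs hp hδ) x).trans ?_
    have := exp_sub_one_le_mul_exp (s := A * ε) (B := A * E) (by positivity) (by gcongr)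
    linarith
  refine (h.abs_log_le_of_logRatio hv x).trans ?_
  have : ε ≤ Real.sqrt E * Real.sqrt ε := by
    calc ε = Real.sqrt ε * Real.sqrt ε := (Real.mul_self_sqrt ε0).symm
      _ ≤ _ := by gcongr
  linarith

end Projective

/-! ### Combinatorics of orbits: the order of the rotation -/

section Order

/-- The map `x ↦ F ^ m x + k`. -/
noncomputable def act (F : CircleDeg1Liftˣ) (m k : ℤ) (x : ℝ) : ℝ :=
  (F ^ m : CircleDeg1Liftˣ) x + k

variable (F : CircleDeg1Liftˣ)

lemma act_act (m k m' k' : ℤ) (x : ℝ) :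
    act F m k (act F m' k' x) = act F (m + m') (k + k') x := by
  simp only [act]
  rw [CircleDeg1Lift.map_add_int, zpow_add, Units.val_mul, CircleDeg1Lift.mul_apply]
  push_cast
  ring

lemma act_zero (k : ℤ) (x : ℝ) : act F 0 k x = x + k := by
  simp [act]

lemma act_natCast (i : ℕ) (k : ℤ) (x : ℝ) : act F i k x = F^[i] x + k := by
  simp only [act]
  rw [zpow_natCast, Units.val_pow_eq_pow_val, CircleDeg1Lift.coe_pow]

lemma act_act_neg (m k : ℤ) (x : ℝ) : act F m k (act F (-m) (-k) x) = x := by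
  simp [act_act, act_zero]

lemma act_strictMono (m k : ℤ) : StrictMono (act F m k) := fun _ _ h =>
  add_lt_add_left ((CircleDeg1Lift.toOrderIso (F ^ m)).strictMono h) _

lemma act_continuous (m k : ℤ) : Continuous (act F m k) :=
  (CircleDeg1Lift.toOrderIso (F ^ m)).continuous.add continuous_const

lemma act_surjective (m k : ℤ) : Function.Surjective (act F m k) := fun x =>
  ⟨_, act_act_neg F m k x⟩

lemma act_add_int (m k l : ℤ) (x : ℝ) : act F m k (x + l) = act F m k x + l := by
  simp only [act, CircleDeg1Lift.map_add_int]
  ring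

lemma act_iterate (m k : ℤ) (i : ℕ) (x : ℝ) : act F m k (F^[i] x) = F^[i] (act F m k x) := by
  have h := fun y => act_natCast F i 0 y
  simp only [Int.cast_zero, add_zero] at h
  rw [← h, ← h, act_act, act_act, add_comm m, add_comm k]

lemma iterate_add_int (i : ℕ) (k : ℤ) (x : ℝ) : F^[i] (x + k) = F^[i] x + k := by
  have h := fun y => act_natCast F i 0 y
  simp only [Int.cast_zero, add_zero] at h
  rw [← h, ← h, act_add_int]

variable {F} {α : ℝ}

/-- The element taking one point to the other has positive translation number, so it moves every
point to the right. This carries arithmetic of `α` over to the orbits of `F`. -/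
lemma act_lt_act (hα : (F : CircleDeg1Lift).translationNumber = α) {m k m' k' : ℤ}
    (h : m * α + k < m' * α + k') (x : ℝ) : act F m k x < act F m' k' x := by
  have h1 : act F m' k' x = act F (m' - m) (k' - k) (act F m k x) := by
    rw [act_act, sub_add_cancel, sub_add_cancel]
  rw [h1]
  have h2 : ((-(k' - k) : ℤ) : ℝ) <
      ((F ^ (m' - m) : CircleDeg1Liftˣ) : CircleDeg1Lift).translationNumber := by
    rw [CircleDeg1Lift.translationNumber_zpow, hα]
    push_cast
    linarith
  have := CircleDeg1Lift.lt_map_of_int_lt_translationNumber _ h2 (act F m k x)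
  conv_rhs => rw [act]
  push_cast at this ⊢
  linarith

lemma act_le_act (hα : (F : CircleDeg1Lift).translationNumber = α) (hirr : Irrational α)
    {m k m' k' : ℤ} (h : m * α + k ≤ m' * α + k') (x : ℝ) : act F m k x ≤ act F m' k' x := by
  rcases h.lt_or_eq with h | h
  · exact (act_lt_act hα h x).le
  · have hm : m = m' := by
      by_contra hne
      have h0 : ((m - m' : ℤ) : ℝ) ≠ 0 := by exact_mod_cast sub_ne_zero.2 hne
      refine hirr ⟨((k' - k : ℤ) : ℚ) / ((m - m' : ℤ) : ℚ), ?_⟩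
      push_cast at h0 ⊢
      rw [div_eq_iff h0]
      linarith
    subst hm
    have : k = k' := by
      have : (k : ℝ) = k' := by linarith
      exact_mod_cast this
    rw [this]

lemma lt_of_act_lt_act (hα : (F : CircleDeg1Lift).translationNumber = α) (hirr : Irrational α)
    {m k m' k' : ℤ} {x : ℝ} (h : act F m k x < act F m' k' x) : m * α + k < m' * α + k' := by
  by_contra! hc
  exact h.not_ge (act_le_act hα hirr hc x)

/-- `q` and `q'` are consecutive closest return times for the rotation of irrational angle `α`;
the rotations by `s α + t` and `s' α + t'`, with `{|s|, |s'|} = {q, q'}`, are the corresponding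
returns, taken in the positive direction. -/
structure IsReturnPair (α : ℝ) (q q' : ℕ) (s t s' t' : ℤ) : Prop where
  irrational : Irrational α
  pos : 0 < q
  le : q ≤ q'
  sign : (s = q ∧ s' = -q') ∨ (s = -q ∧ s' = q')
  return_pos : 0 < s * α + t
  return_pos' : 0 < s' * α + t'
  return_le : s' * α + t' ≤ s * α + t
  return_lt_one : s * α + t < 1
  best : ∀ j : ℤ, j ≠ 0 → |j| < q' → ∀ k : ℤ, s * α + t ≤ |j * α + k|

namespace IsReturnPair

variable {q q' : ℕ} {s t s' t' : ℤ}

lemma lt_act (h : IsReturnPair α q q' s t s' t')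
    (hα : (F : CircleDeg1Lift).translationNumber = α) (x : ℝ) : x < act F s t x := by
  have := act_lt_act hα (m := 0) (k := 0) (m' := s) (k' := t) (by simpa using h.return_pos) x
  simpa [act_zero] using this

lemma act_lt_add_one (h : IsReturnPair α q q' s t s' t')
    (hα : (F : CircleDeg1Lift).translationNumber = α) (x : ℝ) : act F s t x < x + 1 := by
  have := act_lt_act hα (m := s) (k := t) (m' := 0) (k' := 1) (by simpa using h.return_lt_one) x
  simpa [act_zero] using this

/-- The arcs `[F^i x, F^i (G x)]`, `i < q'`, where `G` is the return map, are disjoint. -/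
lemma sum_range_le_one (h : IsReturnPair α q q' s t s' t')
    (hα : (F : CircleDeg1Lift).translationNumber = α) (x : ℝ) :
    ∑ i ∈ Finset.range q', (F^[i] (act F s t x) - F^[i] x) ≤ 1 := by
  -- Translation by `k i` brings `F^[i] x` into `[x, x + 1)`.
  set k : ℕ → ℤ := fun i => -⌊F^[i] x - x⌋ with hk
  have hlow : ∀ i : ℕ, x ≤ act F i (k i) x := fun i => by
    rw [act_natCast, hk]
    push_cast
    linarith [Int.floor_le (F^[i] x - x)]
  have hup : ∀ i : ℕ, act F i (k i) x < x + 1 := fun i => by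
    rw [act_natCast, hk]
    push_cast
    linarith [Int.lt_floor_add_one (F^[i] x - x)]
  have hcomp : ∀ i : ℕ, act F i (k i) (act F s t x) = act F (i + s) (k i + t) x :=
    fun i => act_act F _ _ _ _ x
  have hupG : ∀ i < q', act F i (k i) (act F s t x) ≤ x + 1 := by
    intro i hi
    rw [hcomp]
    have e : x + 1 = act F 0 1 x := by simp [act_zero]
    have h1 : (i : ℝ) * α + k i < 1 := by
      have := hup i
      rw [e] at this
      simpa using lt_of_act_lt_act hα h.irrational this
    rw [e]
    apply act_le_act hα h.irrational
    push_cast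
    -- `best` is silent on `j = 0`, so the first arc rests on `return_lt_one`.
    rcases Nat.eq_zero_or_pos i with rfl | hi0
    · have hk0 : k 0 = 0 := by simp [hk]
      rw [hk0]
      have := h.return_lt_one
      push_cast
      linarith
    · have := h.best i (by exact_mod_cast hi0.ne') (by simpa using hi) (k i - 1)
      push_cast at this
      rw [abs_of_neg (by linarith)] at this
      linarith
  -- Were arcs `i ≠ j` to meet, time `j - i` would return closer than `s * α + t`, against `best`.
  have hdisj : (↑(Finset.range q') : Set ℕ).PairwiseDisjoint
      fun i => Set.Ico (act F i (k i) x) (act F i (k i) (act F s t x)) := by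
    intro i hi j hj hij
    have hi' : i < q' := by simpa using hi
    have hj' : j < q' := by simpa using hj
    have hb := h.best ((j : ℤ) - i) (sub_ne_zero.2 (by exact_mod_cast hij.symm))
      (by rw [abs_lt]; constructor <;> omega) (k j - k i)
    push_cast at hb
    apply Set.disjoint_left.2
    rintro y ⟨hy1, hy2⟩ ⟨hy3, hy4⟩
    rw [hcomp] at hy2 hy4
    have l1 := lt_of_act_lt_act hα h.irrational (hy1.trans_lt hy4)
    have l2 := lt_of_act_lt_act hα h.irrational (hy3.trans_lt hy2)
    push_cast at l1 l2
    have : |((j : ℝ) - i) * α + (k j - k i)| < s * α + t := by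
      rw [abs_lt]
      constructor <;> linarith
    linarith
  have hvol := MeasureTheory.measure_biUnion_finset (μ := MeasureTheory.volume) hdisj
    (fun _ _ => measurableSet_Ico)
  have hsub : (⋃ i ∈ Finset.range q',
      Set.Ico (act F i (k i) x) (act F i (k i) (act F s t x))) ⊆ Set.Ico x (x + 1) := by
    intro y hy
    simp only [Set.mem_iUnion, Finset.mem_range] at hy
    obtain ⟨i, hi, h1, h2⟩ := hy
    exact ⟨(hlow i).trans h1, h2.trans_le (hupG i hi)⟩
  have hle := MeasureTheory.measure_mono (μ := MeasureTheory.volume) hsub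
  rw [hvol] at hle
  simp only [Real.volume_Ico] at hle
  rw [← ENNReal.ofReal_sum_of_nonneg] at hle
  · rw [ENNReal.ofReal_le_ofReal_iff (by linarith)] at hle
    refine (le_of_eq (Finset.sum_congr rfl fun i _ => ?_)).trans (hle.trans (by linarith))
    rw [act_natCast, act_natCast]
    ring
  · intro i _
    exact sub_nonneg.2 ((act_strictMono F _ _).monotone (h.lt_act hα x).le)

lemma iterate_le_iterate_act (h : IsReturnPair α q q' s t s' t')
    (hα : (F : CircleDeg1Lift).translationNumber = α) (i : ℕ) (x : ℝ) :
    F^[i] x ≤ F^[i] (act F s t x) :=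
  (F : CircleDeg1Lift).monotone.iterate i (h.lt_act hα x).le

/-- Covering the circle takes `q + q' ≤ 2 q'` iterates, more than the `q'` with disjoint arcs. -/
lemma sum_range_le_two (h : IsReturnPair α q q' s t s' t')
    (hα : (F : CircleDeg1Lift).translationNumber = α) {l : ℕ} (hl : l ≤ q' + q') (x : ℝ) :
    ∑ i ∈ Finset.range l, (F^[i] (act F s t x) - F^[i] x) ≤ 2 := by
  calc ∑ i ∈ Finset.range l, (F^[i] (act F s t x) - F^[i] x)
      ≤ ∑ i ∈ Finset.range (q' + q'), (F^[i] (act F s t x) - F^[i] x) :=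
        Finset.sum_le_sum_of_subset_of_nonneg (Finset.range_subset_range.2 hl) fun i _ _ =>
          sub_nonneg.2 (h.iterate_le_iterate_act hα i x)
    _ = ∑ i ∈ Finset.range q', (F^[i] (act F s t x) - F^[i] x) +
        ∑ i ∈ Finset.range q', (F^[i] (act F s t (F^[q'] x)) - F^[i] (F^[q'] x)) := by
        rw [Finset.sum_range_add]
        congr 1
        refine Finset.sum_congr rfl fun i _ => ?_
        rw [act_iterate, add_comm q' i, Function.iterate_add_apply, Function.iterate_add_apply]
    _ ≤ 1 + 1 := add_le_add (h.sum_range_le_one hα x) (h.sum_range_le_one hα _)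
    _ = 2 := by norm_num

/-- The arcs `[F^i x, F^i (G x)]`, `i < q + q'`, cover the circle. -/
lemma exists_iterate_le (h : IsReturnPair α q q' s t s' t')
    (hα : (F : CircleDeg1Lift).translationNumber = α) (x z : ℝ) :
    ∃ i < q + q', ∃ k : ℤ, F^[i] x + k ≤ z ∧ z ≤ act F s t (F^[i] x + k) := by
  have hne : (Finset.range (q + q')).Nonempty := ⟨0, by have := h.pos; simp; omega⟩
  -- The orbit point, modulo integers, closest to `z` from the left.
  obtain ⟨i, hi, hmax⟩ := Finset.exists_max_image (Finset.range (q + q'))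
    (fun i => F^[i] x + ⌊z - F^[i] x⌋) hne
  rw [Finset.mem_range] at hi
  refine ⟨i, hi, ⌊z - F^[i] x⌋, by linarith [Int.floor_le (z - F^[i] x)], ?_⟩
  set k := ⌊z - F^[i] x⌋
  -- Since `s` and `s'` have opposite signs, one of `i + s`, `i + s'` stays in `[0, q + q')`. It
  -- yields a point further right by at most one return, which by maximality cannot lie left of `z`.
  obtain ⟨j, u, v, hj, hju, hu0, hu1⟩ : ∃ (j : ℕ) (u v : ℤ), j < q + q' ∧ (j : ℤ) = i + u ∧
      0 < u * α + v ∧ u * α + v ≤ s * α + t := by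
    have hs := h.sign
    have hpos := h.pos
    rcases h.sign with ⟨h1, h2⟩ | ⟨h1, h2⟩
    · rcases lt_or_ge i q' with hc | hc
      · exact ⟨i + q, s, t, by omega, by push_cast; omega, h.return_pos, le_rfl⟩
      · exact ⟨i - q', s', t', by omega, by push_cast [hc]; omega, h.return_pos', h.return_le⟩
    · rcases lt_or_ge i q with hc | hc
      · exact ⟨i + q', s', t', by omega, by push_cast; omega, h.return_pos', h.return_le⟩
      · exact ⟨i - q, s, t, by omega, by push_cast [hc]; omega, h.return_pos, le_rfl⟩
  have e : act F j (k + v) x = act F u v (F^[i] x + k) := by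
    rw [← act_natCast, act_act, hju, add_comm (i : ℤ), add_comm k]
  have hlt : F^[i] x + k < act F u v (F^[i] x + k) := by
    have := act_lt_act hα (m := 0) (k := 0) (by simpa using hu0) (F^[i] x + k)
    simpa [act_zero] using this
  have hle : act F u v (F^[i] x + k) ≤ act F s t (F^[i] x + k) :=
    act_le_act hα h.irrational hu1 _
  refine le_trans ?_ hle
  by_contra! hc
  rw [← e, act_natCast] at hc hlt
  have hm := hmax j (Finset.mem_range.2 hj)
  have hfl : k + v ≤ ⌊z - F^[j] x⌋ := Int.le_floor.2 (by linarith)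
  have hfl' : ((k + v : ℤ) : ℝ) ≤ ⌊z - F^[j] x⌋ := by exact_mod_cast hfl
  linarith

end IsReturnPair

/-- `k` allows for a lift whose translation number differs from the angle by an integer; `t` and
`t'` absorb it. Opposite signs of `s`, `s'` reflect the alternating errors. -/
lemma exists_isReturnPair {ξ : ℝ} (hξ : Irrational ξ) (n : ℕ) (k : ℤ) :
    ∃ (q' : ℕ) (s t s' t' : ℤ),
      IsReturnPair (ξ + k) (ξ.convergent n).den q' s t s' t' ∧
        s = (-1) ^ n * (ξ.convergent n).den := by
  obtain ⟨e, he⟩ : ∃ e : ℤ, e = (-1) ^ n := ⟨_, rfl⟩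
  have he' : ((-1) ^ n : ℝ) = e := by rw [he]; push_cast; rfl
  have he1 : e = 1 ∨ e = -1 := by rw [he]; exact neg_one_pow_eq_or ℤ n
  have h1 := convError_sign hξ n
  have h2 := convError_sign hξ (n + 1)
  have h3 := abs_convError_succ_lt hξ n
  have h4 := abs_convError_lt_one hξ n
  rw [pow_succ, he'] at h2
  rw [he'] at h1
  have h5 : |convError ξ n| = e * convError ξ n := by
    rw [← abs_of_pos h1, abs_mul]
    rcases he1 with h | h <;> simp [h]
  have h6 : |convError ξ (n + 1)| = -e * convError ξ (n + 1) := by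
    have : 0 < -e * convError ξ (n + 1) := by linarith
    rw [← abs_of_pos this, abs_mul]
    rcases he1 with h | h <;> simp [h]
  have r1 : ((e * (ξ.convergent n).den : ℤ) : ℝ) * (ξ + k) +
      ((-e * (ξ.convergent n).num - e * (ξ.convergent n).den * k : ℤ) : ℝ) =
        |convError ξ n| := by
    rw [h5, convError]; push_cast; ring
  have r2 : ((-e * (ξ.convergent (n + 1)).den : ℤ) : ℝ) * (ξ + k) +
      ((e * (ξ.convergent (n + 1)).num + e * (ξ.convergent (n + 1)).den * k : ℤ) : ℝ) =
        |convError ξ (n + 1)| := by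
    rw [h6, convError]; push_cast; ring
  refine ⟨(ξ.convergent (n + 1)).den, e * (ξ.convergent n).den,
    -e * (ξ.convergent n).num - e * (ξ.convergent n).den * k,
    -e * (ξ.convergent (n + 1)).den,
    e * (ξ.convergent (n + 1)).num + e * (ξ.convergent (n + 1)).den * k,
    ⟨hξ.add_intCast k, (ξ.convergent n).den_pos, (convergent_num_den_mono hξ n).1, ?_,
      ?_, ?_, ?_, ?_, ?_⟩, by rw [← he]⟩
  · rcases he1 with h | h
    · exact Or.inl ⟨by rw [h, one_mul], by rw [h, neg_one_mul]⟩
    · exact Or.inr ⟨by rw [h, neg_one_mul], by rw [h, neg_neg, one_mul]⟩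
  · rw [r1, h5]; exact h1
  · rw [r2, h6]; linarith
  · rw [r1, r2]; exact h3.le
  · rw [r1]; exact h4
  · intro j hj hjq l
    rw [r1]
    have := abs_convError_le hξ n hj hjq (j * k + l)
    push_cast at this
    rw [show (j : ℝ) * (ξ + k) + l = j * ξ + (j * k + l) by ring]
    exact this

end Order

/-! ### Distortion along orbits and Denjoy's inequality -/

section Dynamics

/-- A lift `F` of a circle diffeomorphism with derivative `e ^ φ`, of bounded distortion: `φ` is
`K₁`-Lipschitz, and `K` bounds the quadratic distortion of `F`. -/
structure SmoothLift (F : CircleDeg1Liftˣ) (φ : ℝ → ℝ) (K₁ K : ℝ) : Prop where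
  hasDerivAt : ∀ x, HasDerivAt F (Real.exp (φ x)) x
  periodic : Function.Periodic φ 1
  nonneg₁ : 0 ≤ K₁
  nonneg : 0 ≤ K
  lipschitz : ∀ x y, |φ y - φ x| ≤ K₁ * |y - x|
  distortion : ∀ x y, x < y →
    |Real.log ((F y - F x) / (y - x)) - (φ x + φ y) / 2| ≤ K * (y - x) ^ 2

namespace SmoothLift

variable {F : CircleDeg1Liftˣ} {φ : ℝ → ℝ} {K₁ K : ℝ}

lemma iterate_strictMono (F : CircleDeg1Liftˣ) (l : ℕ) : StrictMono F^[l] :=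
  ((CircleDeg1Lift.toOrderIso F).strictMono).iterate l

lemma hasDerivAt_iterate (hF : SmoothLift F φ K₁ K) (l : ℕ) (x : ℝ) :
    HasDerivAt F^[l] (Real.exp (birkhoffSum F φ l x)) x := by
  induction l with
  | zero => simpa using hasDerivAt_id x
  | succ l ih =>
    rw [Function.iterate_succ', birkhoffSum_succ, add_comm, Real.exp_add]
    exact (hF.hasDerivAt _).comp x ih

lemma birkhoffSum_add_int (hF : SmoothLift F φ K₁ K) (l : ℕ) (k : ℤ) (x : ℝ) :
    birkhoffSum F φ l (x + k) = birkhoffSum F φ l x := by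
  refine Finset.sum_congr rfl fun i _ => ?_
  rw [iterate_add_int]
  simpa using hF.periodic.int_mul k (F^[i] x)

lemma abs_log_iterate_le (hF : SmoothLift F φ K₁ K) (l : ℕ) {a b : ℝ} (hab : a < b) :
    |Real.log ((F^[l] b - F^[l] a) / (b - a)) -
      (birkhoffSum F φ l a + birkhoffSum F φ l b) / 2| ≤
        K * ∑ i ∈ Finset.range l, (F^[i] b - F^[i] a) ^ 2 := by
  induction l with
  | zero => simp [div_self (sub_pos.2 hab).ne']
  | succ l ih =>
    have h0 := sub_pos.2 hab
    have h1 := sub_pos.2 (iterate_strictMono F l hab)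
    have h2 := sub_pos.2 (iterate_strictMono F (l + 1) hab)
    have h3 := hF.distortion _ _ (iterate_strictMono F l hab)
    rw [← Function.iterate_succ_apply' F, ← Function.iterate_succ_apply' F] at h3
    have e : (F^[l + 1] b - F^[l + 1] a) / (b - a) =
        (F^[l + 1] b - F^[l + 1] a) / (F^[l] b - F^[l] a) * ((F^[l] b - F^[l] a) / (b - a)) := by
      field_simp
    rw [e, Real.log_mul (by positivity) (by positivity), birkhoffSum_succ, birkhoffSum_succ,
      Finset.sum_range_succ, mul_add]
    rw [abs_le] at *
    constructor <;> linarith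

lemma abs_birkhoffSum_sub_le (hF : SmoothLift F φ K₁ K) (l : ℕ) {a b : ℝ} (hab : a ≤ b) :
    |birkhoffSum F φ l b - birkhoffSum F φ l a| ≤
      K₁ * ∑ i ∈ Finset.range l, (F^[i] b - F^[i] a) := by
  rw [birkhoffSum, birkhoffSum, ← Finset.sum_sub_distrib, Finset.mul_sum]
  refine (Finset.abs_sum_le_sum_abs _ _).trans (Finset.sum_le_sum fun i _ => ?_)
  refine (hF.lipschitz _ _).trans (le_of_eq ?_)
  rw [abs_of_nonneg (sub_nonneg.2 ((iterate_strictMono F i).monotone hab))]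

/-- The iterate has mean slope 1 over a period. -/
lemma exists_birkhoffSum_eq_zero (hF : SmoothLift F φ K₁ K) (l : ℕ) :
    ∃ c, birkhoffSum F φ l c = 0 := by
  obtain ⟨c, -, hc⟩ := exists_hasDerivAt_eq_slope F^[l]
    (fun x => Real.exp (birkhoffSum F φ l x)) (zero_lt_one' ℝ)
    (fun x _ => (hF.hasDerivAt_iterate l x).continuousAt.continuousWithinAt)
    (fun x _ => hF.hasDerivAt_iterate l x)
  refine ⟨c, ?_⟩
  have := iterate_add_int F l 1 0
  simp only [Int.cast_one, zero_add] at this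
  rw [this] at hc
  simpa using hc

variable {α M : ℝ} {q q' : ℕ} {s t s' t' : ℤ}

lemma abs_birkhoffSum_sub_le_of_le (hF : SmoothLift F φ K₁ K)
    (h : IsReturnPair α q q' s t s' t') (hα : (F : CircleDeg1Lift).translationNumber = α)
    {l : ℕ} (hl : l ≤ q' + q') {a b : ℝ} (hab : a ≤ b) (hb : b ≤ act F s t a) :
    |birkhoffSum F φ l b - birkhoffSum F φ l a| ≤ 2 * K₁ := by
  refine (hF.abs_birkhoffSum_sub_le l hab).trans ?_
  rw [mul_comm]
  refine mul_le_mul_of_nonneg_right ((Finset.sum_le_sum fun i _ => ?_).trans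
    (h.sum_range_le_two hα hl a)) hF.nonneg₁
  exact sub_le_sub_right ((iterate_strictMono F i).monotone hb) _

/-- Both sides arise from splitting the sum of length `l + i`. With `l = q`, transport along `i`
iterates becomes a comparison of sums at points one return apart. -/
lemma birkhoffSum_comm (l i : ℕ) (x : ℝ) :
    birkhoffSum F φ l (F^[i] x) - birkhoffSum F φ l x =
      birkhoffSum F φ i (F^[l] x) - birkhoffSum F φ i x := by
  have h1 := birkhoffSum_add F φ i l x
  have h2 := birkhoffSum_add F φ l i x
  rw [add_comm] at h1
  linarith

/-- Denjoy's inequality. -/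
lemma abs_birkhoffSum_le (hF : SmoothLift F φ K₁ K)
    (h : IsReturnPair α q q' s t s' t') (hα : (F : CircleDeg1Lift).translationNumber = α)
    (z : ℝ) : |birkhoffSum F φ q z| ≤ 4 * K₁ := by
  obtain ⟨c, hc⟩ := hF.exists_birkhoffSum_eq_zero q
  obtain ⟨i, hi, k, hk1, hk2⟩ := h.exists_iterate_le hα c z
  have hq := h.le
  have h1 := hF.abs_birkhoffSum_sub_le_of_le h hα (l := q) (by omega) hk1 hk2
  rw [hF.birkhoffSum_add_int] at h1
  have h2 := birkhoffSum_comm (F := F) (φ := φ) q i c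
  have h3 : |birkhoffSum F φ i (F^[q] c) - birkhoffSum F φ i c| ≤ 2 * K₁ := by
    rcases h.sign with ⟨hs, -⟩ | ⟨hs, -⟩
    · have e : act F s t c = F^[q] c + t := by rw [hs, act_natCast]
      have := hF.abs_birkhoffSum_sub_le_of_le h hα (l := i) (by omega) (h.lt_act hα c).le le_rfl
      rwa [e, hF.birkhoffSum_add_int] at this
    · have e : act F s t (F^[q] c + (-t : ℤ)) = c := by
        rw [← act_natCast, act_act, hs]
        simp [act_zero]
      have := hF.abs_birkhoffSum_sub_le_of_le h hα (l := i) (by omega)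
        (h.lt_act hα (F^[q] c + (-t : ℤ))).le le_rfl
      rwa [e, hF.birkhoffSum_add_int, abs_sub_comm] at this
  rw [← h2] at h3
  rw [abs_le] at *
  constructor <;> linarith

/-- Each image of `[a, b]` has length at most `2 * M` and lies in two adjacent return arcs, whose
images have total length at most `2 + 2`. -/
lemma abs_log_iterate_le_of_le (hF : SmoothLift F φ K₁ K)
    (h : IsReturnPair α q q' s t s' t') (hα : (F : CircleDeg1Lift).translationNumber = α)
    (hM : ∀ x, act F s t x - x ≤ M) {l : ℕ} (hl : l ≤ q' + q') {a b : ℝ} (hab : a < b)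
    (hb : b ≤ act F s t (act F s t a)) :
    |Real.log ((F^[l] b - F^[l] a) / (b - a)) -
      (birkhoffSum F φ l a + birkhoffSum F φ l b) / 2| ≤ 8 * K * M := by
  refine (hF.abs_log_iterate_le l hab).trans ?_
  have h1 : ∀ i ∈ Finset.range l, (F^[i] b - F^[i] a) ^ 2 ≤
      2 * M * ((F^[i] (act F s t (act F s t a)) - F^[i] (act F s t a)) +
        (F^[i] (act F s t a) - F^[i] a)) := by
    intro i _
    have c1 : F^[i] a < F^[i] b := iterate_strictMono F i hab
    have c2 : F^[i] b ≤ F^[i] (act F s t (act F s t a)) := (iterate_strictMono F i).monotone hb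
    have c3 := hM (F^[i] a)
    have c4 := hM (F^[i] (act F s t a))
    rw [act_iterate] at c3 c4
    nlinarith
  have hsum := Finset.sum_le_sum h1
  rw [← Finset.mul_sum, Finset.sum_add_distrib] at hsum
  have s1 := h.sum_range_le_two hα hl a
  have s2 := h.sum_range_le_two hα hl (act F s t a)
  have hM0 : 0 ≤ M := by linarith [hM 0, h.lt_act hα 0]
  calc K * ∑ i ∈ Finset.range l, (F^[i] b - F^[i] a) ^ 2 ≤ K * (2 * M * (2 + 2)) :=
        mul_le_mul_of_nonneg_left (hsum.trans (by gcongr)) hF.nonneg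
    _ = 8 * K * M := by ring

/-- Each of the four points is an endpoint once above and once below, so the Birkhoff sums cancel
and four errors `8 * K * M` remain. -/
lemma abs_log_orbitCrossRatio_iterate_sub_le (hF : SmoothLift F φ K₁ K)
    (h : IsReturnPair α q q' s t s' t') (hα : (F : CircleDeg1Lift).translationNumber = α)
    (hM : ∀ x, act F s t x - x ≤ M) {l : ℕ} (hl : l ≤ q' + q') (x : ℝ) :
    |Real.log (orbitCrossRatio (act F s t) (F^[l] x)) -
      Real.log (orbitCrossRatio (act F s t) x)| ≤ 32 * K * M := by
  set G := act F s t with hG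
  have h0 : x < G x := h.lt_act hα _
  have h1 : G x < G (G x) := h.lt_act hα _
  have h2 : G (G x) < G (G (G x)) := h.lt_act hα _
  have h3 : G (G (G x)) < G (G (G (G x))) := h.lt_act hα _
  have d1 := hF.abs_log_iterate_le_of_le h hα hM hl h0 h1.le
  have d2 := hF.abs_log_iterate_le_of_le h hα hM hl (h0.trans h1) le_rfl
  have d3 := hF.abs_log_iterate_le_of_le h hα hM hl (h1.trans h2) le_rfl
  have d4 := hF.abs_log_iterate_le_of_le h hα hM hl h2 h3.le
  have hlog : ∀ {a b c d : ℝ}, 0 < a → 0 < b → 0 < c → 0 < d →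
      Real.log (a * b / (c * d)) = Real.log a + Real.log b - Real.log c - Real.log d := by
    intro a b c d ha hb hc hd
    rw [Real.log_div (by positivity) (by positivity), Real.log_mul ha.ne' hb.ne',
      Real.log_mul hc.ne' hd.ne']
    ring
  have mono := iterate_strictMono F l
  unfold orbitCrossRatio
  rw [hG, act_iterate, act_iterate, act_iterate, ← hG,
    hlog (sub_pos.2 (mono (h0.trans h1))) (sub_pos.2 (mono (h1.trans h2)))
      (sub_pos.2 (mono h0)) (sub_pos.2 (mono h2)),
    hlog (sub_pos.2 (h0.trans h1)) (sub_pos.2 (h1.trans h2)) (sub_pos.2 h0) (sub_pos.2 h2)]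
  rw [Real.log_div (sub_pos.2 (mono h0)).ne' (sub_pos.2 h0).ne'] at d1
  rw [Real.log_div (sub_pos.2 (mono (h0.trans h1))).ne' (sub_pos.2 (h0.trans h1)).ne'] at d2
  rw [Real.log_div (sub_pos.2 (mono (h1.trans h2))).ne' (sub_pos.2 (h1.trans h2)).ne'] at d3
  rw [Real.log_div (sub_pos.2 (mono h2)).ne' (sub_pos.2 h2).ne'] at d4
  rw [abs_le] at *
  constructor <;> linarith

lemma almostMobius_of_pos (hF : SmoothLift F φ K₁ K)
    (h : IsReturnPair α q q' s t s' t') (hα : (F : CircleDeg1Lift).translationNumber = α)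
    (hM : ∀ x, act F s t x - x ≤ M) (hs : s = q) :
    AlmostMobius (act F s t) (fun x => Real.exp (birkhoffSum F φ q x / 2)) (32 * K * M) where
  strictMono := act_strictMono F s t
  lt_map := h.lt_act hα
  pos x := Real.exp_pos _
  dist_map a b hab hb := by
    have hq := h.le
    have d := hF.abs_log_iterate_le_of_le h hα hM (l := q) (by omega) hab hb
    have hM0 : 0 ≤ M := by linarith [hM 0, h.lt_act hα 0]
    have hKM := mul_nonneg hF.nonneg hM0
    refine ⟨_, d.trans (by linarith), ?_⟩
    have h1 := sub_pos.2 hab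
    have h2 := sub_pos.2 (iterate_strictMono F q hab)
    rw [Real.exp_sub, Real.exp_log (div_pos h2 h1), add_div, Real.exp_add, hs, act_natCast,
      act_natCast]
    field_simp
    ring

/-- Here `G` inverts `F^[q]` up to an integer, so the distortion estimate is read backwards from `G
a`, `G b`. -/
lemma almostMobius_of_neg (hF : SmoothLift F φ K₁ K)
    (h : IsReturnPair α q q' s t s' t') (hα : (F : CircleDeg1Lift).translationNumber = α)
    (hM : ∀ x, act F s t x - x ≤ M) (hs : s = -q) :
    AlmostMobius (act F s t) (fun x => Real.exp (-birkhoffSum F φ q (act F s t x) / 2))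
      (32 * K * M) where
  strictMono := act_strictMono F s t
  lt_map := h.lt_act hα
  pos x := Real.exp_pos _
  dist_map a b hab hb := by
    have hq := h.le
    have hab' := act_strictMono F s t hab
    have hinv : ∀ x, F^[q] (act F s t x) = x + t := fun x => by
      have := act_natCast F q 0 (act F s t x)
      rw [Int.cast_zero, add_zero] at this
      rw [← this, act_act, hs]
      simp [act_zero]
    have d := hF.abs_log_iterate_le_of_le h hα hM (l := q) (by omega) hab'
      ((act_strictMono F s t).monotone hb)
    rw [abs_sub_comm, hinv, hinv, add_sub_add_right_eq_sub] at d
    have hM0 : 0 ≤ M := by linarith [hM 0, h.lt_act hα 0]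
    have hKM := mul_nonneg hF.nonneg hM0
    refine ⟨_, d.trans (by linarith), ?_⟩
    have h1 := sub_pos.2 hab
    have h2 := sub_pos.2 hab'
    rw [Real.exp_sub, Real.exp_log (div_pos h1 h2), add_div, Real.exp_add, neg_div, neg_div,
      Real.exp_neg, Real.exp_neg]
    field_simp

/-- The main estimate, on the lift. -/
theorem exists_abs_birkhoffSum_le (hF : SmoothLift F φ K₁ K)
    (hα : (F : CircleDeg1Lift).translationNumber = α) :
    ∃ C : ℝ, ∀ (q q' : ℕ) (s t s' t' : ℤ) (M : ℝ), IsReturnPair α q q' s t s' t' → M ≤ 1 →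
      (∀ x, act F s t x - x ≤ M) → ∀ x, |birkhoffSum F φ q x| ≤ C * Real.sqrt M := by
  have hK1 := hF.nonneg₁
  have hK := hF.nonneg
  -- `V` is half of Denjoy's bound because `P` is the square root of the derivative; `E` bounds `32
  -- * K * M` since `M ≤ 1`.
  obtain ⟨C, -, hC⟩ := exists_abs_log_le_sqrt (V := 2 * K₁) (E := 32 * K) (by linarith)
  refine ⟨2 * C * Real.sqrt (32 * K), fun q q' s t s' t' M h hM1 hM x => ?_⟩
  have hε : 32 * K * M ≤ 32 * K := mul_le_of_le_one_right (by linarith) hM1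
  have hper : ∀ x, act F s t (x + 1) = act F s t x + 1 := fun x => by
    simpa using act_add_int F s t 1 x
  have hq := h.le
  have hcov : ∀ x z, ∃ y, y ≤ z ∧ z ≤ act F s t y ∧
      |Real.log (orbitCrossRatio (act F s t) y) -
        Real.log (orbitCrossRatio (act F s t) x)| ≤ 32 * K * M := by
    intro x z
    obtain ⟨i, hi, k, h1, h2⟩ := h.exists_iterate_le hα x z
    refine ⟨_, h1, h2, ?_⟩
    have : orbitCrossRatio (act F s t) (F^[i] x + k) = orbitCrossRatio (act F s t) (F^[i] x) := by
      unfold orbitCrossRatio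
      simp only [act_add_int, add_sub_add_right_eq_sub]
    rw [this]
    exact hF.abs_log_orbitCrossRatio_iterate_sub_le h hα hM (by omega) x
  have hden := fun x => abs_le.1 (hF.abs_birkhoffSum_le h hα x)
  have hsq : Real.sqrt (32 * K * M) = Real.sqrt (32 * K) * Real.sqrt M :=
    Real.sqrt_mul (by linarith) _
  rcases h.sign with ⟨hs, -⟩ | ⟨hs, -⟩
  · have := hC _ _ _ hε (hF.almostMobius_of_pos h hα hM hs)
      (fun x => ⟨Real.exp_le_exp.2 (by linarith [hden x]), Real.exp_le_exp.2 (by linarith [hden x])⟩)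
      (act_continuous F s t) (act_surjective F s t) hper hcov x
    rw [Real.log_exp, abs_div, abs_two, hsq] at this
    linarith
  · obtain ⟨y, rfl⟩ := act_surjective F s t x
    have := hC _ _ _ hε (hF.almostMobius_of_neg h hα hM hs)
      (fun x => ⟨Real.exp_le_exp.2 (by linarith [hden (act F s t x)]),
        Real.exp_le_exp.2 (by linarith [hden (act F s t x)])⟩)
      (act_continuous F s t) (act_surjective F s t) hper hcov y
    rw [Real.log_exp, abs_div, abs_two, abs_neg, hsq] at this
    linarith

end SmoothLift

/-- The logarithm of the derivative of a lift of a smooth circle diffeomorphism. -/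
lemma exists_smoothLift {F : CircleDeg1Liftˣ} (hF : ContDiff ℝ ∞ (F : ℝ → ℝ))
    (hF' : ContDiff ℝ ∞ (F⁻¹ : CircleDeg1Liftˣ)) :
    ∃ (φ : ℝ → ℝ) (K₁ K : ℝ), SmoothLift F φ K₁ K := by
  have hd : Differentiable ℝ (F : ℝ → ℝ) := hF.differentiable (by simp)
  have hd' : Differentiable ℝ (F⁻¹ : CircleDeg1Liftˣ) := hF'.differentiable (by simp)
  have hpos : ∀ x, 0 < deriv (F : ℝ → ℝ) x := by
    intro x
    refine lt_of_le_of_ne (F : CircleDeg1Lift).monotone.deriv_nonneg fun h0 => ?_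
    have h1 := (hd' (F x)).hasDerivAt.comp x (hd x).hasDerivAt
    have h2 : ((F⁻¹ : CircleDeg1Liftˣ) : ℝ → ℝ) ∘ (F : ℝ → ℝ) = id :=
      funext fun y => CircleDeg1Lift.units_inv_apply_apply F y
    rw [h2, ← h0, mul_zero] at h1
    exact zero_ne_one (h1.unique (hasDerivAt_id x))
  have hcd : ContDiff ℝ ∞ (deriv (F : ℝ → ℝ)) := (contDiff_infty_iff_deriv.1 hF).2
  have hφ : ContDiff ℝ ∞ fun x => Real.log (deriv (F : ℝ → ℝ) x) :=
    hcd.log fun x => (hpos x).ne'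
  set φ : ℝ → ℝ := fun x => Real.log (deriv (F : ℝ → ℝ) x) with hφdef
  obtain ⟨dφ, hφ'⟩ := contDiff_infty_iff_deriv.1 hφ
  obtain ⟨dφ', hφ''⟩ := contDiff_infty_iff_deriv.1 hφ'
  have perd : ∀ {u : ℝ → ℝ}, Function.Periodic u 1 → Function.Periodic (deriv u) 1 := by
    intro u hu x
    rw [← deriv_comp_add_const, show (fun y => u (y + 1)) = u from funext hu]
  have hper : Function.Periodic φ 1 := by
    intro x
    simp only [hφdef]
    rw [← deriv_comp_add_const]
    congr 1
    rw [show (fun y => F (y + 1)) = fun y => F y + 1 from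
      funext (F : CircleDeg1Lift).map_add_one, deriv_add_const]
  have hFd : ∀ x, HasDerivAt F (Real.exp (φ x)) x := fun x => by
    rw [hφdef, Real.exp_log (hpos x)]
    exact (hd x).hasDerivAt
  obtain ⟨K, hK0, hK⟩ := exists_abs_log_slope_le hFd (fun x => (dφ x).hasDerivAt)
    (fun x => (dφ' x).hasDerivAt) hφ''.continuous hper (perd hper) (perd (perd hper))
  obtain ⟨K₁, hK₁0, hK₁⟩ := exists_abs_le_of_periodic hφ'.continuous (perd hper)
  refine ⟨φ, K₁, K, hFd, hper, hK₁0.le, hK0.le, fun x y => ?_, hK⟩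
  exact convex_univ.norm_image_sub_le_of_norm_deriv_le (fun z _ => dφ z) (fun z _ => hK₁ z)
    (Set.mem_univ x) (Set.mem_univ y)

end Dynamics

/-! ### From the lift back to the circle -/

section Circle

lemma isLift_iterate {F : ℝ → ℝ} {f : UnitAddCircle → UnitAddCircle} (h : IsLift F f) (n : ℕ) :
    IsLift F^[n] f^[n] := by
  intro x
  induction n generalizing x with
  | zero => rfl
  | succ n ih => rw [Function.iterate_succ_apply, Function.iterate_succ_apply, ih, h]

lemma arcLength_mem (x y : UnitAddCircle) : arcLength x y ∈ Set.Ico (0 : ℝ) 1 := by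
  have := (AddCircle.equivIco (1 : ℝ) 0 (y - x)).2
  simpa [arcLength] using this

lemma arcLength_coe {x y : ℝ} {k : ℤ} (h : y - x + k ∈ Set.Ico (0 : ℝ) 1) :
    arcLength (x : UnitAddCircle) (y : UnitAddCircle) = y - x + k := by
  have e : (y : UnitAddCircle) - (x : UnitAddCircle) = ((y - x + k : ℝ) : UnitAddCircle) := by
    have hk : ((k : ℝ) : UnitAddCircle) = 0 := (AddCircle.coe_eq_zero_iff (1 : ℝ)).2 ⟨k, by simp⟩
    rw [AddCircle.coe_add, AddCircle.coe_sub, hk, add_zero]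
  rw [arcLength, e, AddCircle.equivIco_coe_eq (by simpa using h)]

lemma beta_mem (f : UnitAddCircle → UnitAddCircle) (n : ℕ) (x : UnitAddCircle) :
    beta f n x ∈ Set.Ico (0 : ℝ) 1 := by
  unfold beta
  split_ifs <;> exact arcLength_mem _ _

lemma beta_le_maxBeta (f : UnitAddCircle → UnitAddCircle) (n : ℕ) (x : UnitAddCircle) :
    beta f n x ≤ maxBeta f n :=
  le_ciSup (f := beta f n) ⟨1, by rintro _ ⟨y, rfl⟩; exact (beta_mem f n y).2.le⟩ x

lemma maxBeta_le_one (f : UnitAddCircle → UnitAddCircle) (n : ℕ) : maxBeta f n ≤ 1 :=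
  ciSup_le fun x => (beta_mem f n x).2.le

lemma exists_translationNumber_eq {F : CircleDeg1Liftˣ} {f : UnitAddCircle → UnitAddCircle}
    (hF : IsLift F f) :
    ∃ k : ℤ, (F : CircleDeg1Lift).translationNumber = rotAngle f + k := by
  have h : ((F : CircleDeg1Lift).translationNumber : UnitAddCircle) =
      ((rotAngle f : ℝ) : UnitAddCircle) := by
    rw [← rotationNumber_eq F hF, rotAngle]
    exact ((AddCircle.equivIco (1 : ℝ) 0).symm_apply_apply _).symm
  have h0 : (((F : CircleDeg1Lift).translationNumber - rotAngle f : ℝ) : UnitAddCircle) = 0 := by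
    rw [AddCircle.coe_sub, h, sub_self]
  obtain ⟨k, hk⟩ := (AddCircle.coe_eq_zero_iff (1 : ℝ)).1 h0
  refine ⟨k, ?_⟩
  rw [zsmul_eq_mul, mul_one] at hk
  linarith

lemma act_sub_le_maxBeta {F : CircleDeg1Liftˣ} {f : UnitAddCircle → UnitAddCircle}
    (hF : IsLift F f) {n : ℕ} {α : ℝ} {q' : ℕ} {s t s' t' : ℤ}
    (hα : (F : CircleDeg1Lift).translationNumber = α)
    (h : IsReturnPair α (qden f n) q' s t s' t') (hs : s = (-1) ^ n * qden f n) (x : ℝ) :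
    act F s t x - x ≤ maxBeta f n := by
  have h1 := h.lt_act hα x
  have h2 := h.act_lt_add_one hα x
  have hmem : act F s t x - x ∈ Set.Ico (0 : ℝ) 1 := ⟨by linarith, by linarith⟩
  rcases Nat.even_or_odd n with hn | hn
  · rw [hn.neg_one_pow, one_mul] at hs
    have e : act F s t x - x = F^[qden f n] x - x + t := by
      rw [hs, act_natCast]; ring
    rw [e] at hmem ⊢
    rw [← arcLength_coe hmem, isLift_iterate hF]
    refine le_trans (le_of_eq ?_) (beta_le_maxBeta f n x)
    rw [beta, if_pos hn]
  -- For odd `n` the displacement at `x` is `β_n` at `act F s t x`, the point that `F^[q_n]` sends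
  -- back to `x` modulo 1.
  · rw [hn.neg_one_pow, neg_one_mul] at hs
    have e : act F s t x - x = act F s t x - F^[qden f n] (act F s t x) + t := by
      have := act_natCast F (qden f n) 0 (act F s t x)
      rw [Int.cast_zero, add_zero, act_act, hs] at this
      rw [hs, ← this]
      simp only [add_neg_cancel, zero_add, act_zero]
      ring
    rw [e] at hmem ⊢
    rw [← arcLength_coe hmem, isLift_iterate hF]
    refine le_trans (le_of_eq ?_) (beta_le_maxBeta f n (act F s t x : ℝ))
    rw [beta, if_neg (Nat.not_even_iff_odd.2 hn)]

end Circle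

end CircleDyn

theorem mainTheorem4 (f : UnitAddCircle → UnitAddCircle) (hf : CircleDyn.IsSmoothDiffeo f)
    (hα : Irrational (CircleDyn.rotAngle f)) :
    ∃ C : ℝ, ∀ (n : ℕ) (x : UnitAddCircle),
      |Real.log (CircleDyn.circleDeriv (f^[CircleDyn.qden f n]) x)| ≤
        C * (CircleDyn.maxBeta f n) ^ (1 / 2 : ℝ) := by
  obtain ⟨F, hF, hF', hlift⟩ := hf
  obtain ⟨φ, K₁, K, hφ⟩ := CircleDyn.exists_smoothLift hF hF'
  obtain ⟨k, hk⟩ := CircleDyn.exists_translationNumber_eq hlift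
  obtain ⟨C, hC⟩ := hφ.exists_abs_birkhoffSum_le hk
  refine ⟨C, fun n x => ?_⟩
  obtain ⟨q', s, t, s', t', hret, hs⟩ := CircleDyn.exists_isReturnPair hα n k
  obtain ⟨x, rfl⟩ := QuotientAddGroup.mk_surjective x
  have hderiv := hφ.hasDerivAt_iterate (CircleDyn.qden f n) x
  have h1 := CircleDyn.circleDeriv_eq_deriv (CircleDyn.isLift_iterate hlift (CircleDyn.qden f n))
    hderiv.continuousAt
  rw [hderiv.deriv] at h1
  rw [← Real.sqrt_eq_rpow]
  refine le_trans (le_of_eq ?_) (hC _ _ _ _ _ _ _ hret (CircleDyn.maxBeta_le_one f n)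
    (CircleDyn.act_sub_le_maxBeta hlift hk hret hs) x)
  refine congrArg abs ((congrArg Real.log h1).trans (Real.log_exp _))
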